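/- **Theorem 1.9.** By a *function field* we mean a field $K$ together with a set $M_K$ of non-trivial non-archimedean absolute values on $K$ satisfying the product formula: for every nonzero $x\in K$, $|x|_v=1$ for all but finitely many $v\in M_K$, and $\prod_{v\in M_K}|x|_v=1$. The *field of constants* of $K$ is $\{x\in K : |x|_v\le 1 \text{ for all } v\in M_K\}$. If $K'/K$ is a finite extension, the places of $K'$ are the absolute values on $K'$ extending some $v\in M_K$ (up to a positive exponent normalizing each of them, which is irrelevant here), and the field of constants of $K'$ is the set of $x\in K'$ with $|x|_w\le 1$ at all of these. A rational map $\varphi\in K(T)$ is *isotrivial* if there are a finite extension $K'/K$ and a Möbius transformation $M\in \mathrm{PGL}_2(K')$ such that $M^{-1}\circ\varphi\circ M$ is defined over the field of constants of $K'$. Let $L$ be a field with a non-archimedean absolute value, with valuation ring $\mathcal O_L$. A rational map $\varphi\in L(T)$ of degree $d$ has *good reduction* over $L$ if $\varphi=[F_1:F_2]$ for some binary forms $F_1,F_2\in\mathcal O_L[x,y]$, homogeneous of degree $d$, whose homogeneous resultant $\mathrm{Res}(F_1,F_2)$ is a unit of $\mathcal O_L$. It has *potentially good reduction* over $L$ if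 there are a finite extension $L'/L$, with an absolute value extending that of $L$, and $M\in\mathrm{PGL}_2(L')$ such that $M^{-1}\circ\varphi\circ M$ has good reduction over $L'$. Let $K$ be a function field and let $\varphi\in K(T)$ be a rational map of degree at least $2$. Then $\varphi$ is isotrivial if and only if, for every $v\in M_K$, $\varphi$ has potentially good reduction over the completion $K_v$ of $K$ at $v$. -/

import Mathlib

open scoped Polynomial

universe u

noncomputable section

namespace RatMap

/-- A family of places making `K` a function field: a set of non-trivial non-archimedean absolute
values on `K` that satisfies the product formula. Nothing else is required of `K` or of the set. -/
structure IsFunctionField {K : Type u} [Field K] (MK : Set (AbsoluteValue K ℝ)) : Prop where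
  nontrivial : ∀ v ∈ MK, v.IsNontrivial
  nonarchimedean : ∀ v ∈ MK, IsNonarchimedean v
  finite_ne_one : ∀ x : K, x ≠ 0 → {v ∈ MK | v x ≠ 1}.Finite
  product_formula : ∀ x : K, x ≠ 0 → ∏ᶠ v : MK, v.1 x = 1

/-- The places of an extension `K'` of `K`: the absolute values on `K'` that extend some member of
`MK`. They are taken without the local-degree exponent that is needed for the product formula on
`K'`; since replacing an absolute value by a positive power of itself does not change its unit ball,
this has no effect on the field of constants of `K'`, the only use made of these places. -/
def extendedPlaces {K : Type u} [Field K] (MK : Set (AbsoluteValue K ℝ))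
    (K' : Type u) [Field K'] [Algebra K K'] : Set (AbsoluteValue K' ℝ) :=
  {w | ∃ v ∈ MK, ∀ x : K, w (algebraMap K K' x) = v x}

/-- The (underlying set of the) field of constants: the elements with absolute value at most `1` at
every place. -/
def constants {K : Type u} [Field K] (MK : Set (AbsoluteValue K ℝ)) : Set K :=
  {x | ∀ v ∈ MK, v x ≤ 1}

/-- `φ` is a quotient of two polynomials all of whose coefficients lie in `k`. -/
def IsDefinedOver {K : Type u} [Field K] (k : Set K) (φ : RatFunc K) : Prop :=
  ∃ P Q : K[X], Q ≠ 0 ∧ (∀ i, P.coeff i ∈ k) ∧ (∀ i, Q.coeff i ∈ k) ∧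
    φ = algebraMap K[X] (RatFunc K) P / algebraMap K[X] (RatFunc K) Q

/-- The degree of a rational map. -/
def degree {K : Type u} [Field K] (φ : RatFunc K) : ℕ :=
  max φ.num.natDegree φ.denom.natDegree

/-- The rational map over `L` obtained from `φ` by applying a field embedding to the
coefficients. -/
def baseChange {K L : Type u} [Field K] [Field L] (i : K →+* L) (φ : RatFunc K) : RatFunc L :=
  algebraMap L[X] (RatFunc L) (φ.num.map i) / algebraMap L[X] (RatFunc L) (φ.denom.map i)

/-- The composition `φ ∘ ψ` of rational functions, for non-constant `ψ`: substitute `ψ` for the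
variable of `φ`. -/
def comp {L : Type u} [Field L] (φ ψ : RatFunc L) : RatFunc L :=
  RatFunc.eval RatFunc.C ψ φ

/-- The Moebius transformation `(a T + b) / (c T + d)` given by an invertible matrix
`!![a, b; c, d]`. It depends only on the class of the matrix in `PGL₂`, and every element of `PGL₂`
is such a class. -/
def moebius {L : Type u} [Field L] (M : GL (Fin 2) L) : RatFunc L :=
  (RatFunc.C (M.1 0 0) * RatFunc.X + RatFunc.C (M.1 0 1)) /
    (RatFunc.C (M.1 1 0) * RatFunc.X + RatFunc.C (M.1 1 1))

/-- The conjugate `M⁻¹ ∘ φ ∘ M`. -/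
def conj {L : Type u} [Field L] (M : GL (Fin 2) L) (φ : RatFunc L) : RatFunc L :=
  comp (moebius M⁻¹) (comp φ (moebius M))

/-- `φ` is isotrivial over `K`. -/
def IsIsotrivialOver {K : Type u} [Field K] (MK : Set (AbsoluteValue K ℝ)) (φ : RatFunc K) : Prop :=
  ∃ M : GL (Fin 2) K, IsDefinedOver (constants MK) (conj M φ)

/-- `φ` is isotrivial: it is isotrivial over some finite extension of `K`. -/
def IsIsotrivial {K : Type u} [Field K] (MK : Set (AbsoluteValue K ℝ)) (φ : RatFunc K) : Prop :=
  ∃ (K' : Type u) (_ : Field K') (_ : Algebra K K'), FiniteDimensional K K' ∧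
    IsIsotrivialOver (extendedPlaces MK K') (baseChange (algebraMap K K') φ)

/-- The one-variable polynomial `F(T, 1)` of a form `F(x, y)`. -/
def dehomogenize {L : Type u} [Field L] (F : MvPolynomial (Fin 2) L) : L[X] :=
  MvPolynomial.aeval ![(Polynomial.X : L[X]), 1] F

/-- The homogeneous resultant of two binary forms of degree `d`: the determinant of their
`2d × 2d` Sylvester matrix. -/
def homogResultant {L : Type u} [Field L] (d : ℕ) (F₁ F₂ : MvPolynomial (Fin 2) L) : L :=
  Polynomial.resultant (dehomogenize F₁) (dehomogenize F₂) d d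

/-- `(F₁, F₂)` is a homogeneous lifting of `φ`: two binary forms of degree `deg φ` without common
linear factor over the algebraic closure (that is, with non-zero resultant) such that
`φ = [F₁ : F₂]`. -/
structure IsHomogeneousLifting {L : Type u} [Field L] (φ : RatFunc L)
    (F₁ F₂ : MvPolynomial (Fin 2) L) : Prop where
  homogeneous_fst : F₁.IsHomogeneous (degree φ)
  homogeneous_snd : F₂.IsHomogeneous (degree φ)
  resultant_ne_zero : homogResultant (degree φ) F₁ F₂ ≠ 0
  eq_div : φ = algebraMap L[X] (RatFunc L) (dehomogenize F₁) /
    algebraMap L[X] (RatFunc L) (dehomogenize F₂)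

/-- `φ` has good reduction over the valued field `(L, w)`: some homogeneous lifting has coefficients
in the valuation ring `{x | w x ≤ 1}` and resultant in its unit group `{x | w x = 1}`. -/
def HasGoodReduction {L : Type u} [Field L] (w : AbsoluteValue L ℝ) (φ : RatFunc L) : Prop :=
  ∃ F₁ F₂ : MvPolynomial (Fin 2) L, IsHomogeneousLifting φ F₁ F₂ ∧
    (∀ m, w (F₁.coeff m) ≤ 1) ∧ (∀ m, w (F₂.coeff m) ≤ 1) ∧
    w (homogResultant (degree φ) F₁ F₂) = 1

/-- `φ` has potentially good reduction over the valued field `(L, w)`: after passing to a finite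
extension `(L', w')` of valued fields, some conjugate of `φ` has good reduction. (If `L` is
complete, every finite extension `L'` carries exactly one such `w'`.) -/
def HasPotentiallyGoodReduction {L : Type u} [Field L] (w : AbsoluteValue L ℝ) (φ : RatFunc L) :
    Prop :=
  ∃ (L' : Type u) (_ : Field L') (_ : Algebra L L') (w' : AbsoluteValue L' ℝ),
    FiniteDimensional L L' ∧ (∀ x : L, w' (algebraMap L L' x) = w x) ∧
    ∃ M : GL (Fin 2) L', HasGoodReduction w' (conj M (baseChange (algebraMap L L') φ))

/-- The canonical embedding of `K` into its completion `K_v`. -/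
def toCompletion {K : Type u} [Field K] (v : AbsoluteValue K ℝ) : K →+* v.Completion :=
  (UniformSpace.Completion.coeRingHom (α := WithAbs v)).comp (WithAbs.equiv v).symm.toRingHom

/-- The absolute value of the completion `K_v`, extending `v`. -/
def completionAbs {K : Type u} [Field K] (v : AbsoluteValue K ℝ) :
    AbsoluteValue v.Completion ℝ :=
  NormedField.toAbsoluteValue v.Completion

theorem completionAbs_toCompletion {K : Type u} [Field K] (v : AbsoluteValue K ℝ) (x : K) :
    completionAbs v (toCompletion v x) = v x :=
  UniformSpace.Completion.norm_coe (E := WithAbs v) ((WithAbs.equiv v).symm x)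

end RatMap

end

/-! Write `e₁ = (1, 0)` and `e₂ = (0, 1)`. Over an algebraic closure, hence over a finite extension
`K'`, a lifting of `φ` of degree `d` can be conjugated to a pair `G` that, as a map of the plane,
fixes `e₁` and sends `e₂` to `e₁` or to `e₂` (`exists_isNormalized`). If `φ` has potentially good
reduction everywhere, all coefficients of `G` turn out to be constants.

Fix a place and suppose that `H = c · B ∘ G ∘ B⁻¹` is integral with unit resultant. The Bézout
identity for the resultant gives `‖H(z)‖ = ‖z‖ ^ d` in the sup norm (`nrm_eval`), that is, `|c| ‖B
G(e)‖ = ‖B e‖ ^ d` for all `e`. Scale `B` so that `‖B e₁‖ = 1`. Then `e = e₁` gives `|c| = 1`, and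
`e = e₂` gives `‖B e₂‖ ≤ 1`, so `B` is integral. The transformation law of the resultant
(`pairRes_sub`) now reads `|Res G| = |det B| ^ (d² - d) ≤ 1`. In case of equality `B` is invertible
over the valuation ring, and `G` is integral (`IsNormalized.good`). Since `|Res G| ≤ 1` at every
place, the product formula forces equality everywhere, so `G` is integral everywhere.

The product formula is used on `K` only. Elements of `K'` are controlled by their minimal
polynomials: the coefficients are symmetric functions of the conjugates (`coeff_minpoly_le_one`),
and the product formula is applied to the constant coefficient.

Conversely, a lifting with constant coefficients has a non-zero constant as resultant, and such a
constant has absolute value `1` at every place. The lifting therefore already has good reduction. -/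

noncomputable section

namespace RatMap

/-! ### Linear substitutions acting on pairs of binary forms -/

section Forms

variable {R : Type*} [CommRing R]

/-- The linear forms given by the rows of a matrix. -/
def linearForm (A : Matrix (Fin 2) (Fin 2) R) (i : Fin 2) : MvPolynomial (Fin 2) R :=
  ∑ j, MvPolynomial.C (A i j) * MvPolynomial.X j

/-- The linear substitution `P ↦ P ∘ A`. -/
def pre (A : Matrix (Fin 2) (Fin 2) R) : MvPolynomial (Fin 2) R →ₐ[R] MvPolynomial (Fin 2) R :=
  MvPolynomial.aeval (linearForm A)

/-- The pair of forms `B ∘ F ∘ A`. -/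
def sub (A B : Matrix (Fin 2) (Fin 2) R) (F : Fin 2 → MvPolynomial (Fin 2) R) (i : Fin 2) :
    MvPolynomial (Fin 2) R :=
  ∑ j, MvPolynomial.C (B i j) * pre A (F j)

theorem aeval_pre {S : Type*} [CommRing S] [Algebra R S] (A : Matrix (Fin 2) (Fin 2) R)
    (x : Fin 2 → S) (P : MvPolynomial (Fin 2) R) :
    MvPolynomial.aeval x (pre A P) =
      MvPolynomial.aeval (fun i => ∑ j, algebraMap R S (A i j) * x j) P := by
  have : (MvPolynomial.aeval x).comp (pre A) =
      MvPolynomial.aeval (R := R) (fun i => ∑ j, algebraMap R S (A i j) * x j) := by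
    ext i
    simp [pre, linearForm]
  exact DFunLike.congr_fun this P

theorem eval_pre (A : Matrix (Fin 2) (Fin 2) R) (z : Fin 2 → R) (P : MvPolynomial (Fin 2) R) :
    MvPolynomial.eval z (pre A P) = MvPolynomial.eval (A.mulVec z) P := by
  exact aeval_pre A z P

theorem eval_sub (A B : Matrix (Fin 2) (Fin 2) R) (F : Fin 2 → MvPolynomial (Fin 2) R)
    (z : Fin 2 → R) :
    (fun i => MvPolynomial.eval z (sub A B F i)) =
      B.mulVec (fun i => MvPolynomial.eval (A.mulVec z) (F i)) := by
  ext i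
  simp [sub, eval_pre, Matrix.mulVec, dotProduct]

theorem pre_pre (A A' : Matrix (Fin 2) (Fin 2) R) (P : MvPolynomial (Fin 2) R) :
    pre A' (pre A P) = pre (A * A') P := by
  have : (pre A').comp (pre A) = pre (A * A') := by
    ext i : 1
    simp only [pre, AlgHom.comp_apply, MvPolynomial.aeval_X, linearForm, map_sum, map_mul,
      MvPolynomial.algHom_C, Matrix.mul_apply, MvPolynomial.algebraMap_eq]
    simp [Fin.sum_univ_two]
    ring
  exact DFunLike.congr_fun this P

theorem pre_one (P : MvPolynomial (Fin 2) R) : pre 1 P = P := by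
  have : pre (1 : Matrix (Fin 2) (Fin 2) R) = AlgHom.id R _ := by
    ext i : 1
    simp [pre, linearForm, Matrix.one_apply]
  rw [this]; rfl

theorem pre_C (A : Matrix (Fin 2) (Fin 2) R) (a : R) :
    pre A (MvPolynomial.C a) = MvPolynomial.C a := by
  simp [pre]

theorem sub_sub (A B A' B' : Matrix (Fin 2) (Fin 2) R) (F : Fin 2 → MvPolynomial (Fin 2) R) :
    sub A' B' (sub A B F) = sub (A * A') (B' * B) F := by
  ext1 i
  simp only [sub, map_mul, pre_C, pre_pre, Matrix.mul_apply, Fin.sum_univ_two, map_add]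
  ring

theorem sub_one_one (F : Fin 2 → MvPolynomial (Fin 2) R) : sub 1 1 F = F := by
  ext1 i
  simp [sub, pre_one, Matrix.one_apply]

theorem pre_map {S : Type*} [CommRing S] (f : R →+* S) (A : Matrix (Fin 2) (Fin 2) R)
    (P : MvPolynomial (Fin 2) R) :
    MvPolynomial.map f (pre A P) = pre (A.map f) (MvPolynomial.map f P) := by
  induction P using MvPolynomial.induction_on with
  | C a => simp [pre]
  | add p q hp hq => simp [hp, hq]
  | mul_X p i hp =>
    rw [map_mul, map_mul, hp, map_mul, map_mul]
    simp [pre, linearForm]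

theorem sub_map {S : Type*} [CommRing S] (f : R →+* S) (A B : Matrix (Fin 2) (Fin 2) R)
    (F : Fin 2 → MvPolynomial (Fin 2) R) :
    (fun i => MvPolynomial.map f (sub A B F i)) =
      sub (A.map f) (B.map f) (fun i => MvPolynomial.map f (F i)) := by
  ext1 i
  simp [sub, pre_map]

theorem isHomogeneous_pre {d : ℕ} (A : Matrix (Fin 2) (Fin 2) R) {P : MvPolynomial (Fin 2) R}
    (hP : P.IsHomogeneous d) : (pre A P).IsHomogeneous d := by
  have h := hP.aeval (linearForm A) (n := 1) (fun i => by
    refine MvPolynomial.IsHomogeneous.sum _ _ _ fun j _ => ?_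
    simpa using (MvPolynomial.isHomogeneous_C (Fin 2) (A i j)).mul
      (MvPolynomial.isHomogeneous_X R j))
  simpa [pre] using h

theorem isHomogeneous_sub {d : ℕ} (A B : Matrix (Fin 2) (Fin 2) R)
    {F : Fin 2 → MvPolynomial (Fin 2) R} (hF : ∀ i, (F i).IsHomogeneous d) (i : Fin 2) :
    (sub A B F i).IsHomogeneous d := by
  refine MvPolynomial.IsHomogeneous.sum _ _ _ fun j _ => ?_
  simpa using (MvPolynomial.isHomogeneous_C (Fin 2) (B i j)).mul (isHomogeneous_pre A (hF j))

theorem eval_smul_of_isHomogeneous {d : ℕ} {P : MvPolynomial (Fin 2) R} (hP : P.IsHomogeneous d)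
    (r : R) (z : Fin 2 → R) :
    MvPolynomial.eval (r • z) P = r ^ d * MvPolynomial.eval z P := by
  rw [MvPolynomial.eval_eq', MvPolynomial.eval_eq', Finset.mul_sum]
  refine Finset.sum_congr rfl fun m hm => ?_
  have hd : m.degree = d := (hP.degree_eq_sum_deg_support hm).symm
  rw [← hd, Finsupp.degree_eq_sum]
  simp only [Pi.smul_apply, smul_eq_mul, mul_pow, Fin.prod_univ_two, Fin.sum_univ_two, pow_add]
  ring

theorem aeval_mul_of_isHomogeneous {S : Type*} [CommRing S] [Algebra R S] {d : ℕ}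
    {P : MvPolynomial (Fin 2) R} (hP : P.IsHomogeneous d) (r : S) (z : Fin 2 → S) :
    MvPolynomial.aeval (r • z) P = r ^ d * MvPolynomial.aeval z P := by
  have := eval_smul_of_isHomogeneous (hP.map (algebraMap R S)) r z
  simpa [MvPolynomial.eval_map, MvPolynomial.aeval_def] using this

theorem pre_smul {d : ℕ} {P : MvPolynomial (Fin 2) R} (hP : P.IsHomogeneous d)
    (r : R) (A : Matrix (Fin 2) (Fin 2) R) :
    pre (r • A) P = MvPolynomial.C (r ^ d) * pre A P := by
  have h : linearForm (r • A) = (MvPolynomial.C r : MvPolynomial (Fin 2) R) • linearForm A := by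
    ext1 i
    simp [linearForm, mul_assoc, mul_add]
  rw [pre, h, aeval_mul_of_isHomogeneous hP, map_pow]
  rfl

end Forms

/-! ### Resultants in formal degree `d` -/

section Resultant

open Polynomial

variable {L : Type*} [Field L]

/-- The resultant of a pair of forms. -/
abbrev pairRes (d : ℕ) (F : Fin 2 → MvPolynomial (Fin 2) L) : L := homogResultant d (F 0) (F 1)

theorem natDegree_dehomogenize_le {d : ℕ} {P : MvPolynomial (Fin 2) L} (hP : P.IsHomogeneous d) :
    (dehomogenize P).natDegree ≤ d := by
  rw [dehomogenize, MvPolynomial.aeval_def, MvPolynomial.eval₂_eq']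
  refine natDegree_sum_le_of_forall_le _ _ fun m hm => ?_
  have hd : m.degree = d := (hP.degree_eq_sum_deg_support hm).symm
  rw [Finsupp.degree_eq_sum] at hd
  simp only [Fin.prod_univ_two, Matrix.cons_val_zero, Matrix.cons_val_one, one_pow, mul_one,
    algebraMap_eq]
  refine (natDegree_C_mul_le _ _).trans ?_
  rw [natDegree_X_pow]
  simp only [Fin.sum_univ_two] at hd
  omega

theorem homogenize_dehomogenize {d : ℕ} {P : MvPolynomial (Fin 2) L} (hP : P.IsHomogeneous d) :
    (dehomogenize P).homogenize d = P :=
  homogenize_eq_of_isHomogeneous hP rfl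

theorem dehomogenize_map {L' : Type*} [Field L'] (f : L →+* L') (P : MvPolynomial (Fin 2) L) :
    dehomogenize (MvPolynomial.map f P) = (dehomogenize P).map f := by
  induction P using MvPolynomial.induction_on with
  | C a => simp [dehomogenize]
  | add p q hp hq =>
    simp only [dehomogenize, map_add, Polynomial.map_add] at hp hq ⊢
    rw [hp, hq]
  | mul_X p i hp =>
    simp only [dehomogenize, map_mul, Polynomial.map_mul] at hp ⊢
    rw [hp]
    fin_cases i <;> simp

theorem pairRes_map {L' : Type*} [Field L'] (f : L →+* L') (d : ℕ)
    (F : Fin 2 → MvPolynomial (Fin 2) L) :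
    pairRes d (fun i => MvPolynomial.map f (F i)) = f (pairRes d F) := by
  rw [pairRes, homogResultant, dehomogenize_map, dehomogenize_map, resultant_map_map]
  rfl

theorem eval_dehomogenize (P : MvPolynomial (Fin 2) L) (t : L) :
    (dehomogenize P).eval t = MvPolynomial.eval ![t, 1] P := by
  induction P using MvPolynomial.induction_on with
  | C a => simp [dehomogenize]
  | add p q hp hq =>
    simp only [dehomogenize, map_add, Polynomial.eval_add] at hp hq ⊢
    rw [hp, hq]
  | mul_X p i hp =>
    simp only [dehomogenize, map_mul, Polynomial.eval_mul] at hp ⊢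
    rw [hp]
    fin_cases i <;> simp

theorem dehomogenize_pre (A : Matrix (Fin 2) (Fin 2) L) (P : MvPolynomial (Fin 2) L) :
    dehomogenize (pre A P) =
      MvPolynomial.aeval ![C (A 0 0) * X + C (A 0 1), C (A 1 0) * X + C (A 1 1)] P := by
  rw [dehomogenize, aeval_pre]
  congr 2
  ext1 i
  fin_cases i <;> simp

/-- Resultants in formal degree `d` scale under degree-preserving operations as those in the actual
degrees. -/
theorem resultant_formal_congr {d : ℕ} {f g f' g' : L[X]} (u : L) (hf : f.natDegree ≤ d)
    (hg : g.natDegree ≤ d) (hf' : f'.natDegree = f.natDegree) (hg' : g'.natDegree = g.natDegree)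
    (hfl : f'.leadingCoeff = u ^ f.natDegree * f.leadingCoeff)
    (hgl : g'.leadingCoeff = u ^ g.natDegree * g.leadingCoeff)
    (h : resultant f' g' = u ^ (f.natDegree * g.natDegree) * resultant f g) :
    resultant f' g' d d = u ^ (d * d) * resultant f g d d := by
  -- If one polynomial has degree exactly `d`, the formal resultant is, up to sign, the actual one
  -- times a power of a leading coefficient; if neither has, it vanishes.
  rcases hf.eq_or_lt with h1 | h1
  · obtain ⟨k, rfl⟩ := Nat.exists_eq_add_of_le hg
    simp only [leadingCoeff] at hfl hgl
    rw [hf'] at h hfl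
    rw [hg'] at h hgl
    rw [h1] at h hfl
    have e1 := resultant_add_right_deg f' g' (g.natDegree + k) g.natDegree k hg'.le
    have e2 := resultant_add_right_deg f g (g.natDegree + k) g.natDegree k le_rfl
    rw [e1, e2, h, hfl]
    ring
  rcases hg.eq_or_lt with h2 | h2
  · obtain ⟨k, rfl⟩ := Nat.exists_eq_add_of_le hf
    simp only [leadingCoeff] at hfl hgl
    rw [hf'] at h hfl
    rw [hg'] at h hgl
    rw [h2] at h hgl
    have e1 := resultant_add_left_deg f' g' f.natDegree (f.natDegree + k) k hf'.le
    have e2 := resultant_add_left_deg f g f.natDegree (f.natDegree + k) k le_rfl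
    rw [e1, e2, h, hgl]
    ring
  rw [resultant_eq_zero_of_lt_lt _ _ _ _ h1 h2,
    resultant_eq_zero_of_lt_lt _ _ _ _ (hf'.trans_lt h1) (hg'.trans_lt h2), mul_zero]

theorem resultant_taylor_formal {d : ℕ} {f g : L[X]} (c : L) (hf : f.natDegree ≤ d)
    (hg : g.natDegree ≤ d) :
    resultant (taylor c f) (taylor c g) d d = resultant f g d d := by
  have := resultant_formal_congr (f' := taylor c f) (g' := taylor c g) 1 hf hg (by simp) (by simp)
    (by simp) (by simp) (by simpa using resultant_taylor f g c)
  simpa using this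

theorem comp_C_mul_X_eq_scaleRoots {u : L} (hu : u ≠ 0) (f : L[X]) :
    f.comp (C u * X) = C (u ^ f.natDegree) * f.scaleRoots u⁻¹ := by
  ext i
  rw [comp_C_mul_X_coeff, coeff_C_mul, coeff_scaleRoots]
  rcases le_or_gt i f.natDegree with h | h
  · obtain ⟨k, hk⟩ := Nat.exists_eq_add_of_le h
    rw [hk, Nat.add_sub_cancel_left, pow_add]
    rw [inv_pow]
    field_simp
  · simp [coeff_eq_zero_of_natDegree_lt h]

theorem resultant_comp_C_mul_X {d : ℕ} {f g : L[X]} {u : L} (hu : u ≠ 0) (hf : f.natDegree ≤ d)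
    (hg : g.natDegree ≤ d) :
    resultant (f.comp (C u * X)) (g.comp (C u * X)) d d = u ^ (d * d) * resultant f g d d := by
  have hdeg : ∀ p : L[X], (p.comp (C u * X)).natDegree = p.natDegree := fun p => by
    rw [natDegree_comp, natDegree_C_mul_X _ hu, mul_one]
  have hl : ∀ p : L[X], (p.comp (C u * X)).leadingCoeff = u ^ p.natDegree * p.leadingCoeff :=
    fun p => by
      rw [leadingCoeff, hdeg, comp_C_mul_X_coeff, mul_comm]; rfl
  refine resultant_formal_congr u hf hg (hdeg f) (hdeg g) (hl f) (hl g) ?_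
  rw [hdeg, hdeg, comp_C_mul_X_eq_scaleRoots hu, comp_C_mul_X_eq_scaleRoots hu,
    resultant_C_mul_left, resultant_C_mul_right]
  have := resultant_scaleRoots f g u⁻¹
  rw [natDegree_scaleRoots, natDegree_scaleRoots] at this
  rw [this]
  rw [← pow_mul, ← pow_mul, inv_pow]
  field_simp
  ring

/-- Reversing the coefficients permutes the Sylvester matrix: all rows are reversed, and so are the
columns within each of the two blocks. The sign is left unspecified because the application uses the
swap twice. -/
theorem exists_resultant_reflect (d : ℕ) :
    ∃ ε : L, ε * ε = 1 ∧ ∀ f g : L[X], f.natDegree ≤ d → g.natDegree ≤ d →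
      resultant (f.reflect d) (g.reflect d) d d = ε * resultant f g d d := by
  let e : Equiv.Perm (Fin (d + d)) :=
    finSumFinEquiv.symm.trans ((Equiv.sumCongr Fin.revPerm Fin.revPerm).trans finSumFinEquiv)
  refine ⟨(Equiv.Perm.sign (Fin.revPerm (n := d + d)) : ℤ) * (Equiv.Perm.sign e : ℤ), ?_, ?_⟩
  · norm_cast
    rw [mul_mul_mul_comm]
    simp
  · intro f g hf hg
    have : sylvester (f.reflect d) (g.reflect d) d d =
        ((sylvester f g d d).submatrix Fin.revPerm id).submatrix id e := by
      ext i j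
      have hi := i.2
      have key : ∀ (p : L[X]) (j : Fin d), p.natDegree ≤ d →
          (if (i : ℕ) ∈ Set.Icc (j : ℕ) (j + d) then (p.reflect d).coeff (i - j) else 0) =
          (if (i.rev : ℕ) ∈ Set.Icc (j.rev : ℕ) (j.rev + d) then
            p.coeff (i.rev - j.rev) else 0) := by
        intro p j hp
        have hj := j.2
        simp only [Set.mem_Icc, Fin.val_rev]
        by_cases h : (j : ℕ) ≤ i ∧ (i : ℕ) ≤ j + d
        · rw [if_pos h, if_pos (by omega), coeff_reflect, revAt_le (by omega)]
          congr 1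
          omega
        · rw [if_neg h, if_neg (by omega)]
      refine j.addCases (fun j => ?_) (fun j => ?_)
      · have he : e (Fin.castAdd d j) = Fin.castAdd d j.rev := by simp [e]
        simp only [sylvester, Matrix.submatrix_apply, Matrix.of_apply, id, he, Fin.addCases_left]
        exact key g j hg
      · have he : e (Fin.natAdd d j) = Fin.natAdd d j.rev := by
          simp only [e, Equiv.trans_apply, finSumFinEquiv_symm_apply_natAdd]
          simp
        simp only [sylvester, Matrix.submatrix_apply, Matrix.of_apply, id, he, Fin.addCases_right]
        exact key f j hf
    rw [resultant, this, Matrix.det_permute', Matrix.det_permute, resultant]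
    ring

theorem aeval_swap_homogenize {d : ℕ} {p : L[X]} (hp : p.natDegree ≤ d) :
    MvPolynomial.aeval ![1, X] (p.homogenize d) = p.reflect d := by
  apply Polynomial.induction_with_natDegree_le
    (fun p ↦ MvPolynomial.aeval ![1, X] (p.homogenize d) = p.reflect d) (N := d)
  · simp
  · intro n r hr hn
    simp [hn, revAt_le hn]
  · intro f g _ _ h1 h2
    simp [h1, h2]
  · exact hp

end Resultant

/-! ### Transformation law of the resultant -/

section Resultant

open Polynomial Matrix

variable {L : Type*} [Field L]

theorem transvection_induction_fin_two (P : Matrix (Fin 2) (Fin 2) L → Prop)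
    (A : Matrix (Fin 2) (Fin 2) L) (hA : A.det ≠ 0)
    (hdiag : ∀ a b : L, a ≠ 0 → b ≠ 0 → P !![a, 0; 0, b])
    (h01 : ∀ c, P !![1, c; 0, 1]) (h10 : ∀ c, P !![1, 0; c, 1])
    (hmul : ∀ A B, A.det ≠ 0 → B.det ≠ 0 → P A → P B → P (A * B)) : P A := by
  refine Matrix.diagonal_transvection_induction_of_det_ne_zero P A hA ?_ ?_ hmul
  · intro D hD
    rw [det_diagonal, Fin.prod_univ_two] at hD
    have : diagonal D = !![D 0, 0; 0, D 1] := by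
      ext i j; fin_cases i <;> fin_cases j <;> simp
    rw [this]
    exact hdiag _ _ (left_ne_zero_of_mul hD) (right_ne_zero_of_mul hD)
  · rintro ⟨i, j, hij, c⟩
    fin_cases i <;> fin_cases j
    · exact absurd rfl hij
    · convert h01 c using 1
      ext i j; fin_cases i <;> fin_cases j <;>
        simp [TransvectionStruct.toMatrix, transvection]
    · convert h10 c using 1
      ext i j; fin_cases i <;> fin_cases j <;>
        simp [TransvectionStruct.toMatrix, transvection]
    · exact absurd rfl hij

theorem sub_left (A B : Matrix (Fin 2) (Fin 2) L) (F : Fin 2 → MvPolynomial (Fin 2) L) :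
    sub A B F = sub 1 B (sub A 1 F) := by
  rw [sub_sub, mul_one, mul_one]

/-- Both sides are multiplicative in `B`, so generators suffice: diagonal matrices scale the two
polynomials, and transvections add a multiple of one to the other, which preserves the resultant. -/
theorem pairRes_post {d : ℕ} (B : Matrix (Fin 2) (Fin 2) L) (hB : B.det ≠ 0)
    {F : Fin 2 → MvPolynomial (Fin 2) L} (hF : ∀ i, (F i).IsHomogeneous d) :
    pairRes d (sub 1 B F) = B.det ^ d * pairRes d F := by
  have hdeh : ∀ (B : Matrix (Fin 2) (Fin 2) L) F i,
      dehomogenize (sub 1 B F i) =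
        C (B i 0) * dehomogenize (F 0) + C (B i 1) * dehomogenize (F 1) := by
    intro B F i
    simp [sub, pre_one, dehomogenize]
  refine transvection_induction_fin_two (fun B => ∀ F : Fin 2 → MvPolynomial (Fin 2) L,
    (∀ i, (F i).IsHomogeneous d) → pairRes d (sub 1 B F) = B.det ^ d * pairRes d F) B hB
    ?_ ?_ ?_ ?_ F hF
  · intro a b _ _ F _
    have e0 : dehomogenize (sub 1 !![a, 0; 0, b] F 0) = C a * dehomogenize (F 0) := by
      rw [hdeh]; simp
    have e1 : dehomogenize (sub 1 !![a, 0; 0, b] F 1) = C b * dehomogenize (F 1) := by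
      rw [hdeh]; simp
    rw [pairRes, homogResultant, e0, e1, resultant_C_mul_left, resultant_C_mul_right, pairRes,
      homogResultant, det_fin_two_of]
    ring
  · intro c F hF
    have e0 : dehomogenize (sub 1 !![1, c; 0, 1] F 0) =
        dehomogenize (F 0) + dehomogenize (F 1) * C c := by
      rw [hdeh]; simp [mul_comm]
    have e1 : dehomogenize (sub 1 !![1, c; 0, 1] F 1) = dehomogenize (F 1) := by
      rw [hdeh]; simp
    rw [pairRes, homogResultant, e0, e1, resultant_add_mul_left _ _ _ _ _ (by simp)
      (natDegree_dehomogenize_le (hF 1)), pairRes, homogResultant]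
    simp
  · intro c F hF
    have e0 : dehomogenize (sub 1 !![1, 0; c, 1] F 0) = dehomogenize (F 0) := by
      rw [hdeh]; simp
    have e1 : dehomogenize (sub 1 !![1, 0; c, 1] F 1) =
        dehomogenize (F 1) + dehomogenize (F 0) * C c := by
      rw [hdeh]; simp [mul_comm, add_comm]
    rw [pairRes, homogResultant, e0, e1, resultant_add_mul_right _ _ _ _ _ (by simp)
      (natDegree_dehomogenize_le (hF 0)), pairRes, homogResultant]
    simp
  · intro A B _ _ hA hB F hF
    rw [← mul_one (1 : Matrix (Fin 2) (Fin 2) L), ← sub_sub, hA _ (isHomogeneous_sub _ _ hF),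
      hB _ hF, det_mul, mul_pow, mul_assoc]

theorem sub_one_right (A : Matrix (Fin 2) (Fin 2) L) (F : Fin 2 → MvPolynomial (Fin 2) L)
    (i : Fin 2) : sub A 1 F i = pre A (F i) := by
  simp [sub, one_apply]

theorem dehomogenize_pre_swap {d : ℕ} {P : MvPolynomial (Fin 2) L} (hP : P.IsHomogeneous d) :
    dehomogenize (pre !![0, 1; 1, 0] P) = (dehomogenize P).reflect d := by
  rw [dehomogenize_pre]
  nth_rw 1 [← homogenize_dehomogenize hP]
  rw [← aeval_swap_homogenize (natDegree_dehomogenize_le hP)]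
  simp

/-- Again generators suffice. Diagonal matrices rescale the variable and upper transvections
translate it. A lower transvection is an upper one conjugated by the swap of the variables, whose
unknown sign then occurs squared. -/
theorem pairRes_pre {d : ℕ} (A : Matrix (Fin 2) (Fin 2) L) (hA : A.det ≠ 0)
    {F : Fin 2 → MvPolynomial (Fin 2) L} (hF : ∀ i, (F i).IsHomogeneous d) :
    pairRes d (sub A 1 F) = A.det ^ (d * d) * pairRes d F := by
  obtain ⟨ε, hε, hswap⟩ := exists_resultant_reflect (L := L) d
  have hsw : ∀ F : Fin 2 → MvPolynomial (Fin 2) L, (∀ i, (F i).IsHomogeneous d) →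
      pairRes d (sub !![0, 1; 1, 0] 1 F) = ε * pairRes d F := by
    intro F hF
    rw [pairRes, homogResultant, sub_one_right, sub_one_right, dehomogenize_pre_swap (hF 0),
      dehomogenize_pre_swap (hF 1), hswap _ _ (natDegree_dehomogenize_le (hF 0))
      (natDegree_dehomogenize_le (hF 1)), pairRes, homogResultant]
  have hmul : ∀ A B : Matrix (Fin 2) (Fin 2) L, A.det ≠ 0 → B.det ≠ 0 →
    (∀ F : Fin 2 → MvPolynomial (Fin 2) L, (∀ i, (F i).IsHomogeneous d) →
      pairRes d (sub A 1 F) = A.det ^ (d * d) * pairRes d F) →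
    (∀ F : Fin 2 → MvPolynomial (Fin 2) L, (∀ i, (F i).IsHomogeneous d) →
      pairRes d (sub B 1 F) = B.det ^ (d * d) * pairRes d F) →
    (∀ F : Fin 2 → MvPolynomial (Fin 2) L, (∀ i, (F i).IsHomogeneous d) →
      pairRes d (sub (A * B) 1 F) = (A * B).det ^ (d * d) * pairRes d F) := by
    intro A B _ _ hA hB F hF
    rw [← mul_one (1 : Matrix (Fin 2) (Fin 2) L), ← sub_sub, hB _ (isHomogeneous_sub _ _ hF),
      hA _ hF, det_mul, mul_pow]
    ring
  have htay : ∀ (c : L) (F : Fin 2 → MvPolynomial (Fin 2) L), (∀ i, (F i).IsHomogeneous d) →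
      pairRes d (sub !![1, c; 0, 1] 1 F) = pairRes d F := by
    intro c F hF
    have : ∀ i, dehomogenize (pre !![1, c; 0, 1] (F i)) = taylor c (dehomogenize (F i)) := by
      intro i
      rw [dehomogenize_pre]
      nth_rw 1 [← homogenize_dehomogenize (hF i)]
      rw [aeval_homogenize_of_eq_one (natDegree_dehomogenize_le (hF i)) _ (by simp)]
      simp [taylor_apply, comp_eq_aeval]
    rw [pairRes, homogResultant, sub_one_right, sub_one_right, this, this,
      resultant_taylor_formal c (natDegree_dehomogenize_le (hF 0))
      (natDegree_dehomogenize_le (hF 1)), pairRes, homogResultant]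
  refine transvection_induction_fin_two (fun A => ∀ F : Fin 2 → MvPolynomial (Fin 2) L,
    (∀ i, (F i).IsHomogeneous d) → pairRes d (sub A 1 F) = A.det ^ (d * d) * pairRes d F) A hA
    ?_ ?_ ?_ hmul F hF
  · intro a b ha hb F hF
    have : ∀ i, dehomogenize (pre !![a, 0; 0, b] (F i)) =
        C (b ^ d) * (dehomogenize (F i)).comp (C (a / b) * X) := by
      intro i
      rw [dehomogenize_pre]
      have h1 : ![C (!![a, 0; 0, b] 0 0) * X + C (!![a, 0; 0, b] 0 1),
          C (!![a, 0; 0, b] 1 0) * X + C (!![a, 0; 0, b] 1 1)] =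
          (C b : L[X]) • ![C (a / b) * X, 1] := by
        ext1 i
        fin_cases i
        · simp [← mul_assoc, ← C_mul, mul_div_cancel₀ _ hb]
        · simp
      rw [h1, aeval_mul_of_isHomogeneous (hF i), C_pow]
      congr 1
      nth_rw 1 [← homogenize_dehomogenize (hF i)]
      rw [aeval_homogenize_of_eq_one (natDegree_dehomogenize_le (hF i)) _ (by simp)]
      simp [comp_eq_aeval]
    rw [pairRes, homogResultant, sub_one_right, sub_one_right, this, this,
      resultant_C_mul_left, resultant_C_mul_right,
      resultant_comp_C_mul_X (div_ne_zero ha hb) (natDegree_dehomogenize_le (hF 0))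
      (natDegree_dehomogenize_le (hF 1)), pairRes, homogResultant, det_fin_two_of, div_pow,
      mul_zero, sub_zero, ← pow_mul, mul_pow]
    field_simp
  · intro c F hF
    rw [htay c F hF]
    simp
  · intro c F hF
    have : !![1, 0; c, 1] = !![0, 1; 1, 0] * !![1, c; 0, 1] * !![0, 1; 1, (0 : L)] := by
      simp
    rw [this, ← mul_one (1 : Matrix (Fin 2) (Fin 2) L), ← sub_sub,
      hsw _ (isHomogeneous_sub _ _ hF), ← mul_one (1 : Matrix (Fin 2) (Fin 2) L), ← sub_sub,
      htay _ _ (isHomogeneous_sub _ _ hF), hsw _ hF, ← mul_assoc, hε]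
    simp

theorem pairRes_sub {d : ℕ} {A B : Matrix (Fin 2) (Fin 2) L} (hA : A.det ≠ 0) (hB : B.det ≠ 0)
    {F : Fin 2 → MvPolynomial (Fin 2) L} (hF : ∀ i, (F i).IsHomogeneous d) :
    pairRes d (sub A B F) = A.det ^ (d * d) * B.det ^ d * pairRes d F := by
  rw [sub_left, pairRes_post B hB (isHomogeneous_sub _ _ hF), pairRes_pre A hA hF]
  ring

theorem pairRes_smul {d : ℕ} (c : L) (F : Fin 2 → MvPolynomial (Fin 2) L) :
    pairRes d (fun i => MvPolynomial.C c * F i) = c ^ (2 * d) * pairRes d F := by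
  have h : ∀ i, dehomogenize (MvPolynomial.C c * F i) = C c * dehomogenize (F i) := by
    intro i
    simp [dehomogenize]
  rw [pairRes, homogResultant, h, h, resultant_C_mul_left, resultant_C_mul_right, pairRes,
    homogResultant]
  ring

theorem isCoprime_of_resultant_ne_zero {d : ℕ} (hd : d ≠ 0) {f g : L[X]} (hf : f.natDegree ≤ d)
    (hg : g.natDegree ≤ d) (h : resultant f g d d ≠ 0) : IsCoprime f g := by
  obtain ⟨p, q, -, -, hpq⟩ := exists_mul_add_mul_eq_C_resultant f g hf hg (Or.inl hd)
  refine ⟨C (resultant f g d d)⁻¹ * p, C (resultant f g d d)⁻¹ * q, ?_⟩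
  rw [mul_assoc, mul_assoc, ← mul_add, mul_comm p, mul_comm q, hpq, ← C_mul,
    inv_mul_cancel₀ h, C_1]

/-- One of the polynomials attains the formal degree, so for `d > 0` the formal resultant differs
from the actual one by a non-zero factor. -/
theorem resultant_ne_zero_of_isCoprime {d : ℕ} {f g : L[X]} (h : IsCoprime f g)
    (hd : max f.natDegree g.natDegree = d) : resultant f g d d ≠ 0 := by
  have h0 := resultant_ne_zero f g h
  have hf0 : f.natDegree = d → 0 < d → f.coeff f.natDegree ≠ 0 := by
    intro h1 h2 h3
    rw [coeff_natDegree, leadingCoeff_eq_zero] at h3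
    subst h3
    simp at h1
    omega
  have hg0 : g.natDegree = d → 0 < d → g.coeff g.natDegree ≠ 0 := by
    intro h1 h2 h3
    rw [coeff_natDegree, leadingCoeff_eq_zero] at h3
    subst h3
    simp at h1
    omega
  rcases Nat.eq_zero_or_pos d with rfl | hd0
  · have h1 : f.natDegree = 0 := by omega
    have h2 : g.natDegree = 0 := by omega
    rwa [h1, h2] at h0
  rcases le_total g.natDegree f.natDegree with h1 | h1
  · have h2 : f.natDegree = d := by omega
    obtain ⟨k, hk⟩ := Nat.exists_eq_add_of_le h1
    rw [← h2]
    nth_rw 2 [hk]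
    rw [resultant_add_right_deg f g f.natDegree g.natDegree k le_rfl]
    exact mul_ne_zero (pow_ne_zero _ (hf0 h2 hd0)) h0
  · have h2 : g.natDegree = d := by omega
    obtain ⟨k, hk⟩ := Nat.exists_eq_add_of_le h1
    rw [← h2]
    nth_rw 1 [hk]
    rw [resultant_add_left_deg f g f.natDegree g.natDegree k le_rfl]
    exact mul_ne_zero (mul_ne_zero (pow_ne_zero _ (by simp)) (pow_ne_zero _ (hg0 h2 hd0))) h0

end Resultant

/-! ### Homogeneous liftings of rational maps and their conjugates -/

section Lift

open Polynomial

variable {L : Type u} [Field L]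

/-- `F` is a pair of forms of degree `d` with non-zero resultant that represents `φ`. -/
structure IsLift (d : ℕ) (φ : RatFunc L) (F : Fin 2 → MvPolynomial (Fin 2) L) : Prop where
  hom : ∀ i, (F i).IsHomogeneous d
  res_ne_zero : pairRes d F ≠ 0
  eq_div : φ = algebraMap L[X] (RatFunc L) (dehomogenize (F 0)) /
    algebraMap L[X] (RatFunc L) (dehomogenize (F 1))

theorem isHomogeneousLifting_iff {φ : RatFunc L} {F : Fin 2 → MvPolynomial (Fin 2) L} :
    IsHomogeneousLifting φ (F 0) (F 1) ↔ IsLift (degree φ) φ F :=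
  ⟨fun h => ⟨Fin.forall_fin_two.2 ⟨h.1, h.2⟩, h.3, h.4⟩, fun h => ⟨h.1 0, h.1 1, h.2, h.3⟩⟩

theorem exists_C_mul_of_div_eq_div {f g f' g' : L[X]} (hg : g ≠ 0) (hg' : g' ≠ 0)
    (h : IsCoprime f g) (h' : IsCoprime f' g')
    (heq : algebraMap L[X] (RatFunc L) f / algebraMap L[X] (RatFunc L) g =
      algebraMap L[X] (RatFunc L) f' / algebraMap L[X] (RatFunc L) g') :
    ∃ c : L, c ≠ 0 ∧ f' = C c * f ∧ g' = C c * g := by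
  have hm : f * g' = f' * g := by
    rw [div_eq_div_iff (RatFunc.algebraMap_ne_zero hg) (RatFunc.algebraMap_ne_zero hg'),
      ← map_mul, ← map_mul] at heq
    exact RatFunc.algebraMap_injective L heq
  have h1 : g ∣ g' := h.symm.dvd_of_dvd_mul_left (hm ▸ dvd_mul_left g f')
  have h2 : g' ∣ g := h'.symm.dvd_of_dvd_mul_left (hm ▸ dvd_mul_left g' f)
  obtain ⟨u, hu⟩ := associated_of_dvd_dvd h1 h2
  obtain ⟨c, hc, hcu⟩ := isUnit_iff.1 u.isUnit
  refine ⟨c, hc.ne_zero, ?_, ?_⟩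
  · apply mul_right_cancel₀ hg
    rw [← hm, ← hu, ← hcu]
    ring
  · rw [← hu, ← hcu, mul_comm]

theorem degree_div {p q : L[X]} (hq : q ≠ 0) (h : IsCoprime p q) :
    degree (algebraMap L[X] (RatFunc L) p / algebraMap L[X] (RatFunc L) q) =
      max p.natDegree q.natDegree := by
  obtain ⟨c, hc, h1, h2⟩ := exists_C_mul_of_div_eq_div hq (RatFunc.denom_ne_zero _) h
    (RatFunc.isCoprime_num_denom _) (RatFunc.num_div_denom
      (algebraMap L[X] (RatFunc L) p / algebraMap L[X] (RatFunc L) q)).symm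
  rw [degree, h1, h2, natDegree_C_mul hc, natDegree_C_mul hc]

namespace IsLift

variable {d : ℕ} {φ : RatFunc L} {F G : Fin 2 → MvPolynomial (Fin 2) L}

theorem natDegree_le (h : IsLift d φ F) (i : Fin 2) : (dehomogenize (F i)).natDegree ≤ d :=
  natDegree_dehomogenize_le (h.hom i)

theorem isCoprime (h : IsLift d φ F) (hd : d ≠ 0) :
    IsCoprime (dehomogenize (F 0)) (dehomogenize (F 1)) :=
  isCoprime_of_resultant_ne_zero hd (h.natDegree_le 0) (h.natDegree_le 1) h.res_ne_zero

theorem snd_ne_zero (h : IsLift d φ F) (hd : d ≠ 0) : dehomogenize (F 1) ≠ 0 := by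
  intro h0
  have := h.res_ne_zero
  rw [pairRes, homogResultant, h0, resultant_zero_right, zero_pow hd, zero_mul] at this
  exact this rfl

theorem degree_eq (h : IsLift d φ F) (hd : d ≠ 0) : degree φ = d := by
  rw [h.eq_div, degree_div (h.snd_ne_zero hd) (h.isCoprime hd)]
  refine le_antisymm (max_le (h.natDegree_le 0) (h.natDegree_le 1)) ?_
  by_contra hlt
  rw [not_le, max_lt_iff] at hlt
  exact h.res_ne_zero (resultant_eq_zero_of_lt_lt _ _ _ _ hlt.1 hlt.2)

/-- A reduced fraction determines its numerator and denominator up to a common constant. This is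
what compares a lifting of good reduction with a conjugate of a given lifting. -/
theorem unique (h : IsLift d φ F) (h' : IsLift d φ G) (hd : d ≠ 0) :
    ∃ c : L, c ≠ 0 ∧ G = fun i => MvPolynomial.C c * F i := by
  obtain ⟨c, hc, h1, h2⟩ := exists_C_mul_of_div_eq_div (h.snd_ne_zero hd) (h'.snd_ne_zero hd)
    (h.isCoprime hd) (h'.isCoprime hd) (h.eq_div.symm.trans h'.eq_div)
  refine ⟨c, hc, funext <| Fin.forall_fin_two.2 ⟨?_, ?_⟩⟩
  · rw [← homogenize_dehomogenize (h'.hom 0), h1, homogenize_C_mul,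
      homogenize_dehomogenize (h.hom 0)]
  · rw [← homogenize_dehomogenize (h'.hom 1), h2, homogenize_C_mul,
      homogenize_dehomogenize (h.hom 1)]

theorem smul (h : IsLift d φ F) {c : L} (hc : c ≠ 0) :
    IsLift d φ (fun i => MvPolynomial.C c * F i) where
  hom i := by simpa using (MvPolynomial.isHomogeneous_C (Fin 2) c).mul (h.hom i)
  res_ne_zero := by
    rw [pairRes_smul]
    exact mul_ne_zero (pow_ne_zero _ hc) h.res_ne_zero
  eq_div := by
    have : ∀ i, dehomogenize (MvPolynomial.C c * F i) = C c * dehomogenize (F i) := by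
      intro i
      simp [dehomogenize]
    rw [this, this, map_mul, map_mul, mul_div_mul_left _ _
      (RatFunc.algebraMap_ne_zero (C_ne_zero.2 hc))]
    exact h.eq_div

end IsLift

theorem exists_isLift (φ : RatFunc L) : ∃ F, IsLift (degree φ) φ F := by
  have h0 : φ.num.natDegree ≤ degree φ := le_max_left _ _
  have h1 : φ.denom.natDegree ≤ degree φ := le_max_right _ _
  have e0 : dehomogenize (φ.num.homogenize (degree φ)) = φ.num := aeval_homogenize_X_one _ h0
  have e1 : dehomogenize (φ.denom.homogenize (degree φ)) = φ.denom := aeval_homogenize_X_one _ h1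
  refine ⟨![φ.num.homogenize (degree φ), φ.denom.homogenize (degree φ)], ?_, ?_, ?_⟩
  · exact Fin.forall_fin_two.2 ⟨isHomogeneous_homogenize _, isHomogeneous_homogenize _⟩
  · simp only [pairRes, homogResultant, Matrix.cons_val_zero, Matrix.cons_val_one]
    rw [e0, e1]
    exact resultant_ne_zero_of_isCoprime (RatFunc.isCoprime_num_denom φ) rfl
  · simp only [Matrix.cons_val_zero, Matrix.cons_val_one]
    rw [e0, e1, RatFunc.num_div_denom]

theorem baseChange_div {L' : Type u} [Field L'] (i : L →+* L') {p q : L[X]} (hq : q ≠ 0) :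
    baseChange i (algebraMap L[X] (RatFunc L) p / algebraMap L[X] (RatFunc L) q) =
      algebraMap L'[X] (RatFunc L') (p.map i) / algebraMap L'[X] (RatFunc L') (q.map i) := by
  set φ := algebraMap L[X] (RatFunc L) p / algebraMap L[X] (RatFunc L) q with hφ
  have h1 : φ.num * q = p * φ.denom := (RatFunc.num_mul_eq_mul_denom_iff hq).2 hφ
  have h2 : φ.denom ≠ 0 := RatFunc.denom_ne_zero φ
  rw [baseChange, div_eq_div_iff
    (RatFunc.algebraMap_ne_zero (Polynomial.map_ne_zero h2))
    (RatFunc.algebraMap_ne_zero (Polynomial.map_ne_zero hq)), ← map_mul,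
    ← map_mul, ← Polynomial.map_mul, ← Polynomial.map_mul, h1]

theorem IsLift.baseChange {d : ℕ} {φ : RatFunc L} {F : Fin 2 → MvPolynomial (Fin 2) L}
    (h : IsLift d φ F) (hd : d ≠ 0) {L' : Type u} [Field L'] (i : L →+* L') :
    IsLift d (baseChange i φ) (fun j => MvPolynomial.map i (F j)) where
  hom j := (h.hom j).map i
  res_ne_zero := by
    rw [pairRes_map]
    exact (map_ne_zero i).2 h.res_ne_zero
  eq_div := by
    rw [h.eq_div, baseChange_div i (h.snd_ne_zero hd), dehomogenize_map, dehomogenize_map]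

theorem degree_baseChange {L' : Type u} [Field L'] (i : L →+* L') (φ : RatFunc L) :
    degree (baseChange i φ) = degree φ := by
  have h : IsCoprime (φ.num.map i) (φ.denom.map i) :=
    (RatFunc.isCoprime_num_denom φ).map (mapRingHom i)
  rw [baseChange, degree_div (Polynomial.map_ne_zero (RatFunc.denom_ne_zero φ)) h, natDegree_map,
    natDegree_map, degree]

/-- A non-constant `χ` is transcendental, so substituting it is a field embedding. No denominator
vanishes, and the fraction need not be reduced. -/
theorem comp_div {χ : RatFunc L} (hχ : ¬∃ c, χ = RatFunc.C c) (p q : L[X]) :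
    comp (algebraMap L[X] (RatFunc L) p / algebraMap L[X] (RatFunc L) q) χ =
      aeval χ p / aeval χ q := by
  have ht := RatFunc.transcendental_of_ne_C χ hχ
  have h : ∀ ψ : RatFunc L, comp ψ χ = RatFunc.algEquivOfTranscendental χ ht ψ := by
    intro ψ
    rw [RatFunc.algEquivOfTranscendental_apply]
    rfl
  rw [h, map_div₀, IntermediateField.coe_div, RatFunc.algEquivOfTranscendental_algebraMap,
    RatFunc.algEquivOfTranscendental_algebraMap]
  have h2 : ∀ p : L[X], ((aeval (IntermediateField.AdjoinSimple.gen L χ) p :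
      IntermediateField.adjoin L {χ}) : RatFunc L) = aeval χ p := fun p =>
    (aeval_algHom_apply (IntermediateField.val _) (IntermediateField.AdjoinSimple.gen L χ) p).symm
  rw [h2, h2]

theorem algebraMap_dehomogenize (P : MvPolynomial (Fin 2) L) :
    algebraMap L[X] (RatFunc L) (dehomogenize P) = MvPolynomial.aeval ![RatFunc.X, 1] P := by
  have : (IsScalarTower.toAlgHom L L[X] (RatFunc L)).comp (MvPolynomial.aeval ![(X : L[X]), 1]) =
      MvPolynomial.aeval ![RatFunc.X, 1] := by
    ext i
    fin_cases i <;> simp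
  exact DFunLike.congr_fun this P

theorem aeval_dehomogenize {S : Type*} [Field S] [Algebra L S] {d : ℕ}
    {P : MvPolynomial (Fin 2) L} (hP : P.IsHomogeneous d) (z : Fin 2 → S) (hz : z 1 ≠ 0) :
    z 1 ^ d * aeval (z 0 / z 1) (dehomogenize P) = MvPolynomial.aeval z P := by
  have h : z = z 1 • ![z 0 / z 1, 1] := by
    ext i
    fin_cases i <;> simp [mul_div_cancel₀ _ hz]
  conv_rhs => rw [h, aeval_mul_of_isHomogeneous hP]
  congr 1
  nth_rw 2 [← homogenize_dehomogenize hP]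
  rw [aeval_homogenize_of_eq_one (natDegree_dehomogenize_le hP) _ (by simp)]
  simp

theorem moebius_eq (M : GL (Fin 2) L) :
    moebius M = algebraMap L[X] (RatFunc L) (C (M.1 0 0) * X + C (M.1 0 1)) /
      algebraMap L[X] (RatFunc L) (C (M.1 1 0) * X + C (M.1 1 1)) := by
  simp [moebius]

theorem linear_ne_zero (M : GL (Fin 2) L) : C (M.1 1 0) * X + C (M.1 1 1) ≠ (0 : L[X]) := by
  intro h
  have hdet : M.1.det ≠ 0 := M.det.ne_zero
  have h0 := congrArg (fun p => coeff p 0) h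
  have h1 := congrArg (fun p => coeff p 1) h
  simp at h0 h1
  exact hdet (by rw [Matrix.det_fin_two, h0, h1]; ring)

theorem moebius_ne_C (M : GL (Fin 2) L) : ¬∃ c, moebius M = RatFunc.C c := by
  rintro ⟨c, hc⟩
  have hdet : M.1.det ≠ 0 := M.det.ne_zero
  rw [moebius_eq, div_eq_iff (RatFunc.algebraMap_ne_zero (linear_ne_zero M)),
    ← RatFunc.algebraMap_C, ← map_mul] at hc
  have h := RatFunc.algebraMap_injective L hc
  have h0 := congrArg (fun p => coeff p 0) h
  have h1 := congrArg (fun p => coeff p 1) h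
  simp at h0 h1
  exact hdet (by rw [Matrix.det_fin_two, h0, h1]; ring)

namespace IsLift

variable {d : ℕ} {φ : RatFunc L} {F : Fin 2 → MvPolynomial (Fin 2) L}

theorem ne_C (h : IsLift d φ F) (hd : d ≠ 0) : ¬∃ c, φ = RatFunc.C c := by
  rintro ⟨c, rfl⟩
  have := h.degree_eq hd
  simp [degree] at this
  exact hd this.symm

theorem comp_moebius (h : IsLift d φ F) (M : GL (Fin 2) L) :
    IsLift d (comp φ (moebius M)) (sub M.1 1 F) where
  hom := isHomogeneous_sub _ _ h.hom
  res_ne_zero := by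
    rw [pairRes_sub M.det.ne_zero (by simp) h.hom]
    exact mul_ne_zero (mul_ne_zero (pow_ne_zero _ M.det.ne_zero) (by simp)) h.res_ne_zero
  eq_div := by
    rw [sub_one_right, sub_one_right, algebraMap_dehomogenize, algebraMap_dehomogenize, aeval_pre,
      aeval_pre]
    set z : Fin 2 → RatFunc L :=
      fun i => ∑ j, algebraMap L (RatFunc L) (M.1 i j) * ![RatFunc.X, 1] j with hz
    have hz1 : z 1 ≠ 0 := by
      have := RatFunc.algebraMap_ne_zero (linear_ne_zero M)
      simpa [hz, Fin.sum_univ_two] using this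
    have hm : moebius M = z 0 / z 1 := by
      simp [hz, moebius]
    conv_lhs => rw [h.eq_div, comp_div (moebius_ne_C M), hm]
    rw [← aeval_dehomogenize (h.hom 0) z hz1, ← aeval_dehomogenize (h.hom 1) z hz1,
      mul_div_mul_left _ _ (pow_ne_zero _ hz1)]

theorem moebius_comp (h : IsLift d φ F) (hd : d ≠ 0) (M : GL (Fin 2) L) :
    IsLift d (comp (moebius M) φ) (sub 1 M.1 F) where
  hom := isHomogeneous_sub _ _ h.hom
  res_ne_zero := by
    rw [pairRes_sub (by simp) M.det.ne_zero h.hom]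
    exact mul_ne_zero (mul_ne_zero (by simp) (pow_ne_zero _ M.det.ne_zero)) h.res_ne_zero
  eq_div := by
    have h1 : ∀ i, dehomogenize (sub 1 M.1 F i) =
        C (M.1 i 0) * dehomogenize (F 0) + C (M.1 i 1) * dehomogenize (F 1) := by
      intro i
      simp [sub, pre_one, dehomogenize]
    have h2 := RatFunc.algebraMap_ne_zero (h.snd_ne_zero hd)
    rw [moebius_eq, comp_div (h.ne_C hd), h1, h1]
    simp only [map_add, map_mul, aeval_X, aeval_C, RatFunc.algebraMap_C, RatFunc.algebraMap_eq_C]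
    rw [← mul_div_mul_right _ _ h2]
    have h3 := (eq_div_iff h2).1 h.eq_div
    congr 1 <;> rw [add_mul, mul_assoc, h3]

theorem conj (h : IsLift d φ F) (hd : d ≠ 0) (M : GL (Fin 2) L) :
    IsLift d (conj M φ) (sub M.1 M⁻¹.1 F) := by
  rw [sub_left]
  exact (h.comp_moebius M).moebius_comp hd M⁻¹

end IsLift

end Lift

/-! ### Good reduction at one non-archimedean absolute value -/

section Local

open Polynomial

variable {L : Type*} [Field L] {w : AbsoluteValue L ℝ}

/-- The valuation ring of a non-archimedean absolute value. -/
def integers (hw : IsNonarchimedean w) : Subring L where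
  carrier := {x | w x ≤ 1}
  mul_mem' {a b} ha hb := by
    simp only [Set.mem_ofPred_eq, map_mul] at *
    exact mul_le_one₀ ha (w.nonneg b) hb
  one_mem' := by simp
  add_mem' {a b} ha hb := (hw a b).trans (max_le ha hb)
  zero_mem' := by simp
  neg_mem' {a} ha := by simpa using ha

theorem mem_integers {hw : IsNonarchimedean w} {x : L} : x ∈ integers hw ↔ w x ≤ 1 := Iff.rfl

/-- All coefficients of the form lie in the valuation ring. -/
def IsIntegralForm (w : AbsoluteValue L ℝ) (P : MvPolynomial (Fin 2) L) : Prop :=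
  ∀ m, w (P.coeff m) ≤ 1

theorem isIntegralForm_iff {hw : IsNonarchimedean w} {P : MvPolynomial (Fin 2) L} :
    IsIntegralForm w P ↔ P ∈ (MvPolynomial.map (σ := Fin 2) (integers hw).subtype).range := by
  rw [← SetLike.mem_coe, RingHom.coe_range, MvPolynomial.mem_range_map_iff_coeffs_subset]
  constructor
  · rintro h x hx
    obtain ⟨m, -, rfl⟩ := MvPolynomial.mem_coeffs_iff.1 hx
    exact ⟨⟨_, h m⟩, rfl⟩
  · intro h m
    by_cases hm : m ∈ P.support
    · obtain ⟨x, hx⟩ := h (MvPolynomial.mem_coeffs_iff.2 ⟨m, hm, rfl⟩)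
      rw [← hx]
      exact x.2
    · rw [MvPolynomial.notMem_support_iff.1 hm]
      simp

theorem IsIntegralForm.C_mul {c : L} (hc : w c ≤ 1)
    {P : MvPolynomial (Fin 2) L} (hP : IsIntegralForm w P) :
    IsIntegralForm w (MvPolynomial.C c * P) := by
  intro m
  rw [MvPolynomial.coeff_C_mul, map_mul]
  exact mul_le_one₀ hc (w.nonneg _) (hP m)

theorem IsIntegralForm.sub (hw : IsNonarchimedean w) {A B : Matrix (Fin 2) (Fin 2) L}
    (hA : ∀ i j, w (A i j) ≤ 1) (hB : ∀ i j, w (B i j) ≤ 1)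
    {F : Fin 2 → MvPolynomial (Fin 2) L} (hF : ∀ i, IsIntegralForm w (F i)) (i : Fin 2) :
    IsIntegralForm w (sub A B F i) := by
  have : ∀ j, ∃ P, MvPolynomial.map (integers hw).subtype P = F j := fun j =>
    (isIntegralForm_iff (hw := hw)).1 (hF j)
  choose P hP using this
  refine (isIntegralForm_iff (hw := hw)).2 ⟨RatMap.sub (Matrix.of fun i j => ⟨A i j, hA i j⟩)
    (Matrix.of fun i j => ⟨B i j, hB i j⟩) P i, ?_⟩
  have := congrFun (sub_map (integers hw).subtype (Matrix.of fun i j => ⟨A i j, hA i j⟩)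
    (Matrix.of fun i j => ⟨B i j, hB i j⟩) P) i
  rw [this]
  simp only [hP]
  rfl

/-- The supremum norm of a vector. -/
def nrm (w : AbsoluteValue L ℝ) (z : Fin 2 → L) : ℝ := max (w (z 0)) (w (z 1))

theorem le_nrm (z : Fin 2 → L) (i : Fin 2) : w (z i) ≤ nrm w z := by
  fin_cases i
  · exact le_max_left _ _
  · exact le_max_right _ _

theorem nrm_smul (r : L) (z : Fin 2 → L) : nrm w (r • z) = w r * nrm w z := by
  simp [nrm, mul_max_of_nonneg _ _ (w.nonneg r)]

theorem nrm_nonneg (z : Fin 2 → L) : 0 ≤ nrm w z := (w.nonneg _).trans (le_nrm z 0)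

theorem exists_nrm_eq (z : Fin 2 → L) : ∃ r, w r = nrm w z := by
  rcases max_choice (w (z 0)) (w (z 1)) with h | h
  · exact ⟨z 0, h.symm⟩
  · exact ⟨z 1, h.symm⟩

theorem eval_le_one (hw : IsNonarchimedean w) {P : MvPolynomial (Fin 2) L}
    (hP : IsIntegralForm w P) {z : Fin 2 → L} (hz : ∀ i, w (z i) ≤ 1) :
    w (MvPolynomial.eval z P) ≤ 1 := by
  rw [← mem_integers (hw := hw), MvPolynomial.eval_eq']
  exact Subring.sum_mem _ fun m _ => Subring.mul_mem _ (hP m)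
    (Subring.prod_mem _ fun i _ => Subring.pow_mem _ (hz i) _)

theorem exists_coeff_dehomogenize_eq {d : ℕ} {P : MvPolynomial (Fin 2) L}
    (hP : P.IsHomogeneous d) (i : ℕ) :
    (dehomogenize P).coeff i = 0 ∨ ∃ m, (dehomogenize P).coeff i = P.coeff m := by
  rcases le_or_gt i d with h | h
  · right
    have h1 := coeff_homogenize (dehomogenize P) d
      (Finsupp.single 0 i + Finsupp.single 1 (d - i))
    rw [homogenize_dehomogenize hP, if_pos (by simp; omega)] at h1
    refine ⟨Finsupp.single 0 i + Finsupp.single 1 (d - i), ?_⟩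
    rw [h1]
    simp
  · left
    exact coeff_eq_zero_of_natDegree_lt ((natDegree_dehomogenize_le hP).trans_lt h)

theorem coeff_dehomogenize_le_one {d : ℕ} {P : MvPolynomial (Fin 2) L}
    (hP : P.IsHomogeneous d) (hPi : IsIntegralForm w P) (i : ℕ) :
    w ((dehomogenize P).coeff i) ≤ 1 := by
  rcases exists_coeff_dehomogenize_eq hP i with h | ⟨m, hm⟩
  · simp [h]
  · rw [hm]
    exact hPi m

/-- The resultant is a combination of the two polynomials with integral cofactors. Evaluated at an
integral point, this exhibits a unit as such a combination of the two values, which cannot both be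
small. -/
theorem one_le_nrm_eval (hw : IsNonarchimedean w) {d : ℕ} (hd : d ≠ 0)
    {H : Fin 2 → MvPolynomial (Fin 2) L} (hH : ∀ i, (H i).IsHomogeneous d)
    (hi : ∀ i, IsIntegralForm w (H i)) (hres : w (pairRes d H) = 1) {t : L} (ht : w t ≤ 1) :
    1 ≤ nrm w (fun i => MvPolynomial.eval ![t, 1] (H i)) := by
  have hl : ∀ i, ∃ f : (integers hw)[X],
      f.natDegree ≤ d ∧ f.map (integers hw).subtype = dehomogenize (H i) := by
    intro i
    have : dehomogenize (H i) ∈ Polynomial.lifts (integers hw).subtype := by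
      rw [Polynomial.lifts_iff_coeff_lifts]
      exact fun n => ⟨⟨_, coeff_dehomogenize_le_one (hH i) (hi i) n⟩, rfl⟩
    obtain ⟨f, hf⟩ := (Polynomial.mem_lifts _).1 this
    refine ⟨f, ?_, hf⟩
    rw [← natDegree_map_eq_of_injective (integers hw).subtype_injective f, hf]
    exact natDegree_dehomogenize_le (hH i)
  choose f hfd hf using hl
  obtain ⟨p, q, -, -, hpq⟩ := exists_mul_add_mul_eq_C_resultant (f 0) (f 1) (hfd 0) (hfd 1)
    (Or.inl hd)
  have h1 := congrArg (fun P => Polynomial.eval t (P.map (integers hw).subtype)) hpq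
  simp only [Polynomial.map_add, Polynomial.map_mul, hf, Polynomial.eval_add, Polynomial.eval_mul,
    eval_dehomogenize, Polynomial.map_C, Polynomial.eval_C] at h1
  rw [← resultant_map_map, hf, hf] at h1
  change _ = pairRes d H at h1
  have hint : ∀ p : (integers hw)[X], w ((p.map (integers hw).subtype).eval t) ≤ 1 := by
    intro p
    rw [eval_map, show t = (integers hw).subtype ⟨t, ht⟩ from rfl, eval₂_at_apply]
    exact (eval _ p).2
  rw [← hres, ← h1]
  refine (hw _ _).trans (max_le_max ?_ ?_) <;> rw [map_mul]
  · exact mul_le_of_le_one_right (w.nonneg _) (hint p)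
  · exact mul_le_of_le_one_right (w.nonneg _) (hint q)

theorem nrm_eval_of_le (hw : IsNonarchimedean w) {d : ℕ} (hd : d ≠ 0)
    {H : Fin 2 → MvPolynomial (Fin 2) L} (hH : ∀ i, (H i).IsHomogeneous d)
    (hi : ∀ i, IsIntegralForm w (H i)) (hres : w (pairRes d H) = 1) {z : Fin 2 → L}
    (hz : w (z 0) ≤ w (z 1)) :
    nrm w (fun i => MvPolynomial.eval z (H i)) = nrm w z ^ d := by
  have hn : nrm w z = w (z 1) := max_eq_right hz
  by_cases h1 : z 1 = 0
  · have h0 : z 0 = 0 := by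
      rw [h1, map_zero] at hz
      exact w.eq_zero.1 (le_antisymm hz (w.nonneg _))
    have hz0 : z = (0 : L) • z := by
      ext i
      fin_cases i <;> simp [h0, h1]
    have : (fun i => MvPolynomial.eval z (H i)) =
        (0 : L) ^ d • fun i => MvPolynomial.eval z (H i) := by
      ext i
      conv_lhs => rw [hz0, eval_smul_of_isHomogeneous (hH i)]
      rfl
    rw [this, nrm_smul, hn, h1]
    simp [hd]
  · have hw1 : 0 < w (z 1) := w.pos h1
    have ht : w (z 0 / z 1) ≤ 1 := by
      rw [map_div₀]
      exact div_le_one_of_le₀ hz hw1.le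
    have hzt : z = z 1 • ![z 0 / z 1, 1] := by
      ext i
      fin_cases i <;> simp [mul_div_cancel₀ _ h1]
    have : (fun i => MvPolynomial.eval z (H i)) =
        z 1 ^ d • fun i => MvPolynomial.eval ![z 0 / z 1, 1] (H i) := by
      ext i
      conv_lhs => rw [hzt, eval_smul_of_isHomogeneous (hH i)]
      rfl
    rw [this, nrm_smul, hn, map_pow]
    have h2 : nrm w (fun i => MvPolynomial.eval ![z 0 / z 1, 1] (H i)) = 1 := by
      refine le_antisymm ?_ (one_le_nrm_eval hw hd hH hi hres ht)
      have : ∀ i, w (![z 0 / z 1, 1] i) ≤ 1 := Fin.forall_fin_two.2 ⟨ht, by simp⟩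
      exact max_le (eval_le_one hw (hi 0) this) (eval_le_one hw (hi 1) this)
    rw [h2, mul_one]

/-- By homogeneity it suffices to evaluate at vectors with one coordinate `1` and the other
integral. Swapping the variables makes the second coordinate the larger one and changes the
resultant only by a sign. -/
theorem nrm_eval (hw : IsNonarchimedean w) {d : ℕ} (hd : d ≠ 0)
    {H : Fin 2 → MvPolynomial (Fin 2) L} (hH : ∀ i, (H i).IsHomogeneous d)
    (hi : ∀ i, IsIntegralForm w (H i)) (hres : w (pairRes d H) = 1) (z : Fin 2 → L) :
    nrm w (fun i => MvPolynomial.eval z (H i)) = nrm w z ^ d := by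
  rcases le_total (w (z 0)) (w (z 1)) with h | h
  · exact nrm_eval_of_le hw hd hH hi hres h
  · have h1 := nrm_eval_of_le (z := ![z 1, z 0]) hw hd
      (isHomogeneous_sub !![0, 1; 1, 0] 1 hH)
      (IsIntegralForm.sub hw (A := !![0, 1; 1, 0]) (B := 1)
        (by intro i j; fin_cases i <;> fin_cases j <;> simp)
        (by intro i j; fin_cases i <;> fin_cases j <;> simp) hi)
      (by rw [pairRes_sub (by simp) (by simp) hH]; simp [hres]) (by simpa using h)
    have h2 : Matrix.mulVec !![0, 1; 1, 0] ![z 1, z 0] = z := by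
      ext i
      fin_cases i <;> simp
    rw [eval_sub, h2, Matrix.one_mulVec] at h1
    rw [h1, nrm, nrm, max_comm]
    simp

theorem det_le_one (hw : IsNonarchimedean w) {B : Matrix (Fin 2) (Fin 2) L}
    (hB : ∀ i j, w (B i j) ≤ 1) : w B.det ≤ 1 := by
  rw [Matrix.det_fin_two, ← mem_integers (hw := hw)]
  exact Subring.sub_mem _ (Subring.mul_mem _ (hB _ _) (hB _ _))
    (Subring.mul_mem _ (hB _ _) (hB _ _))

theorem inv_le_one {A B : Matrix (Fin 2) (Fin 2) L}
    (hBA : B * A = 1) (hB : ∀ i j, w (B i j) ≤ 1) (hdet : w B.det = 1) (i j : Fin 2) :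
    w (A i j) ≤ 1 := by
  have hA : A = B⁻¹ := (Matrix.inv_eq_right_inv hBA).symm
  rw [hA, Matrix.inv_def, Matrix.adjugate_fin_two]
  fin_cases i <;> fin_cases j <;> simp [hdet, hB]

/-- The pair of forms fixes the first basis vector and sends the second one to a basis vector. -/
structure IsNormalized (F : Fin 2 → MvPolynomial (Fin 2) L) : Prop where
  fst : (fun i => MvPolynomial.eval ![1, 0] (F i)) = ![1, 0]
  snd : (fun i => MvPolynomial.eval ![0, 1] (F i)) = ![1, 0] ∨
    (fun i => MvPolynomial.eval ![0, 1] (F i)) = ![0, 1]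

/-- The core of the local argument: the norm identity at the two basis vectors bounds the columns of
`B`, and the resultant of `F` then measures how far `B` is from being invertible over the valuation
ring. -/
theorem IsNormalized.good_of_nrm_eq_one (hw : IsNonarchimedean w) {d : ℕ} (hd : 2 ≤ d)
    {F : Fin 2 → MvPolynomial (Fin 2) L} (hF : ∀ i, (F i).IsHomogeneous d)
    (hN : IsNormalized F) {A B : Matrix (Fin 2) (Fin 2) L} (hBA : B * A = 1) (hAB : A * B = 1)
    {c : L} (hi : ∀ i, IsIntegralForm w (MvPolynomial.C c * sub A B F i))
    (hres : w (pairRes d fun i => MvPolynomial.C c * sub A B F i) = 1)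
    (hB0 : nrm w (B.mulVec ![1, 0]) = 1) :
    w (pairRes d F) ≤ 1 ∧ (w (pairRes d F) = 1 → ∀ i, IsIntegralForm w (F i)) := by
  have hd0 : d ≠ 0 := by omega
  have hdetBA : B.det * A.det = 1 := by rw [← Matrix.det_mul, hBA, Matrix.det_one]
  have hdetA : A.det ≠ 0 := right_ne_zero_of_mul_eq_one hdetBA
  have hdetB : B.det ≠ 0 := left_ne_zero_of_mul_eq_one hdetBA
  -- This is `nrm_eval` for the good conjugate, evaluated at `B e`; there `A` cancels `B`.
  have key : ∀ e : Fin 2 → L, w c * nrm w (B.mulVec fun i => MvPolynomial.eval e (F i)) =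
      nrm w (B.mulVec e) ^ d := by
    intro e
    rw [← nrm_eval hw hd0 (fun i => by
      simpa using (MvPolynomial.isHomogeneous_C (Fin 2) c).mul (isHomogeneous_sub A B hF i))
      hi hres, ← nrm_smul]
    have h := eval_sub A B F (B.mulVec e)
    rw [Matrix.mulVec_mulVec, hAB, Matrix.one_mulVec] at h
    rw [← h]
    simp only [map_mul, MvPolynomial.eval_C]
    rfl
  have hc : w c = 1 := by
    have := key ![1, 0]
    rwa [hN.fst, hB0, one_pow, mul_one] at this
  have hc0 : c ≠ 0 := by
    rintro rfl
    simp at hc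
  -- Either the `d`-th power of this norm is `1`, or the norm equals its own `d`-th power, which is
  -- impossible above `1` since `d ≥ 2`.
  have hB1 : nrm w (B.mulVec ![0, 1]) ≤ 1 := by
    have h1 := key ![0, 1]
    rcases hN.snd with h | h
    · rw [h, hc, hB0, one_mul] at h1
      exact ((pow_eq_one_iff_of_nonneg (nrm_nonneg _) hd0).1 h1.symm).le
    · rw [h, hc, one_mul] at h1
      by_contra hlt
      rw [not_le] at hlt
      exact (lt_self_pow₀ hlt (by omega)).ne h1
  have hB : ∀ i j, w (B i j) ≤ 1 := by
    intro i j
    fin_cases j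
    · have := (le_nrm (w := w) (B.mulVec ![1, 0]) i).trans hB0.le
      simpa [Matrix.mulVec, dotProduct] using this
    · have := (le_nrm (w := w) (B.mulVec ![0, 1]) i).trans hB1
      simpa [Matrix.mulVec, dotProduct] using this
  have hwA : w A.det * w B.det = 1 := by rw [← map_mul, mul_comm, hdetBA, map_one]
  -- The law gives `1 = |det A| ^ (d²) |det B| ^ d |Res F|`, and `det A` is inverse to `det B`. The
  -- exponent `d² - d` is positive, so a unit resultant makes `det B` a unit.
  have hresF : w (pairRes d F) = w B.det ^ (d * d - d) := by
    rw [pairRes_smul, pairRes_sub hdetA hdetB hF, map_mul, map_mul, map_mul, map_pow, map_pow,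
      map_pow, hc, one_pow, one_mul] at hres
    have hdd : d * d = (d * d - d) + d := (Nat.sub_add_cancel (Nat.le_mul_self d)).symm
    generalize d * d - d = n at *
    rw [hdd, pow_add] at hres
    calc w (pairRes d F) = w B.det ^ n * ((w A.det ^ n * w A.det ^ d) * w B.det ^ d *
          w (pairRes d F)) := by
          have e1 : w A.det ^ n * w B.det ^ n = 1 := by rw [← mul_pow, hwA, one_pow]
          have e2 : w A.det ^ d * w B.det ^ d = 1 := by rw [← mul_pow, hwA, one_pow]
          linear_combination (-w (pairRes d F)) * e1 -
            w (pairRes d F) * w A.det ^ n * w B.det ^ n * e2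
      _ = _ := by rw [hres, mul_one]
  have hdB := det_le_one hw hB
  refine ⟨hresF ▸ pow_le_one₀ (w.nonneg _) hdB, fun h1 => ?_⟩
  have hdet1 : w B.det = 1 := by
    rw [hresF] at h1
    refine (pow_eq_one_iff_of_nonneg (w.nonneg _) ?_).1 h1
    have : d < d * d := by nlinarith
    omega
  have hA := inv_le_one hBA hB hdet1
  have hFeq : F = sub B A (fun i => MvPolynomial.C c⁻¹ * (MvPolynomial.C c * sub A B F i)) := by
    have : (fun i => MvPolynomial.C c⁻¹ * (MvPolynomial.C c * sub A B F i)) = sub A B F := by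
      ext1 i
      rw [← mul_assoc, ← MvPolynomial.C_mul, inv_mul_cancel₀ hc0, MvPolynomial.C_1, one_mul]
    rw [this, sub_sub, hAB, sub_one_one]
  intro i
  rw [hFeq]
  exact IsIntegralForm.sub hw hB hA
    (fun i => (hi i).C_mul (by rw [map_inv₀, hc, inv_one])) i

/-- The maximum norm of a vector is the absolute value of some coordinate `r`, so `B` can be divided
by `r` within the field to reach norm `1` on the first basis vector. -/
theorem IsNormalized.good (hw : IsNonarchimedean w) {d : ℕ} (hd : 2 ≤ d)
    {F : Fin 2 → MvPolynomial (Fin 2) L} (hF : ∀ i, (F i).IsHomogeneous d)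
    (hN : IsNormalized F) {A B : Matrix (Fin 2) (Fin 2) L} (hBA : B * A = 1)
    {c : L} (hi : ∀ i, IsIntegralForm w (MvPolynomial.C c * sub A B F i))
    (hres : w (pairRes d fun i => MvPolynomial.C c * sub A B F i) = 1) :
    w (pairRes d F) ≤ 1 ∧ (w (pairRes d F) = 1 → ∀ i, IsIntegralForm w (F i)) := by
  have hAB : A * B = 1 := mul_eq_one_comm.1 hBA
  obtain ⟨r, hr⟩ := exists_nrm_eq (w := w) (B.mulVec ![1, 0])
  have hr0 : r ≠ 0 := by
    rintro rfl
    rw [map_zero] at hr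
    have h0 : B.mulVec ![1, 0] = 0 := by
      ext i
      exact w.eq_zero.1 (le_antisymm ((le_nrm _ i).trans hr.ge) (w.nonneg _))
    have h1 : (A * B).mulVec ![1, 0] = 0 := by rw [← Matrix.mulVec_mulVec, h0, Matrix.mulVec_zero]
    rw [hAB, Matrix.one_mulVec] at h1
    simpa using congrFun h1 0
  -- Replacing `(A, B)` by `(r A, r⁻¹ B)` multiplies the pair by `r ^ d * r⁻¹`; the inverse factor
  -- is absorbed into `c`.
  have hscale : ∀ i, sub A B F i = MvPolynomial.C (r * (r ^ d)⁻¹) * sub (r • A) (r⁻¹ • B) F i := by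
    intro i
    simp only [sub, pre_smul (hF _), Matrix.smul_apply, smul_eq_mul, Finset.mul_sum]
    refine Finset.sum_congr rfl fun j _ => ?_
    rw [← mul_assoc, ← mul_assoc, ← MvPolynomial.C_mul, ← MvPolynomial.C_mul]
    congr 2
    field_simp
  simp only [hscale, ← mul_assoc, ← MvPolynomial.C_mul] at hi hres
  refine hN.good_of_nrm_eq_one hw hd hF (A := r • A) (B := r⁻¹ • B) ?_ ?_ hi hres ?_
  · simp [hBA, smul_smul, hr0]
  · simp [hAB, smul_smul, hr0]
  · rw [Matrix.smul_mulVec, nrm_smul, map_inv₀, hr, inv_mul_cancel₀]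
    rw [← hr]
    exact (w.pos hr0).ne'

end Local

/-! ### Fixed points, preimages and the normal form -/

section FixedPoints

open Polynomial

variable {L : Type*} [Field L]

theorem eval_one_zero {d : ℕ} {P : MvPolynomial (Fin 2) L} (hP : P.IsHomogeneous d) :
    MvPolynomial.eval ![1, 0] P = (dehomogenize P).coeff d := by
  have h := eval_dehomogenize (pre !![0, 1; 1, 0] P) 0
  rw [dehomogenize_pre_swap hP, eval_pre] at h
  have h2 : Matrix.mulVec !![0, 1; 1, 0] ![(0 : L), 1] = ![1, 0] := by
    ext i
    fin_cases i <;> simp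
  rw [h2] at h
  rw [← h, ← coeff_zero_eq_eval_zero, coeff_reflect, revAt_zero]

theorem eq_zero_of_eval_eq_zero {d : ℕ} (hd : d ≠ 0) {F : Fin 2 → MvPolynomial (Fin 2) L}
    (hF : ∀ i, (F i).IsHomogeneous d) (hres : pairRes d F ≠ 0) {z : Fin 2 → L}
    (hz : ∀ i, MvPolynomial.eval z (F i) = 0) : z = 0 := by
  by_contra hz0
  by_cases h1 : z 1 = 0
  · have h0 : z 0 ≠ 0 := by
      intro h0
      refine hz0 (funext fun i => ?_)
      fin_cases i
      · exact h0
      · exact h1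
    have hzt : z = z 0 • ![1, 0] := by
      ext i
      fin_cases i <;> simp [h1]
    have hc : ∀ i, (dehomogenize (F i)).natDegree < d := by
      intro i
      have h2 := hz i
      rw [hzt, eval_smul_of_isHomogeneous (hF i), eval_one_zero (hF i)] at h2
      refine lt_of_le_of_ne (natDegree_dehomogenize_le (hF i)) fun h => ?_
      have h3 := (mul_eq_zero.1 h2).resolve_left (pow_ne_zero _ h0)
      nth_rw 1 [← h] at h3
      rw [coeff_natDegree, leadingCoeff_eq_zero] at h3
      rw [h3, natDegree_zero] at h
      exact hd h.symm
    exact hres (resultant_eq_zero_of_lt_lt _ _ _ _ (hc 0) (hc 1))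
  · have hzt : z = z 1 • ![z 0 / z 1, 1] := by
      ext i
      fin_cases i <;> simp [mul_div_cancel₀ _ h1]
    have hr : ∀ i, (dehomogenize (F i)).eval (z 0 / z 1) = 0 := by
      intro i
      have h2 := hz i
      rw [hzt, eval_smul_of_isHomogeneous (hF i), ← eval_dehomogenize] at h2
      exact (mul_eq_zero.1 h2).resolve_left (pow_ne_zero _ h1)
    obtain ⟨a, b, hab⟩ := isCoprime_of_resultant_ne_zero hd (natDegree_dehomogenize_le (hF 0))
      (natDegree_dehomogenize_le (hF 1)) hres
    have := congrArg (eval (z 0 / z 1)) hab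
    simp [hr] at this

theorem exists_det_ne_zero_mulVec {z : Fin 2 → L} (hz : z ≠ 0) :
    ∃ A : Matrix (Fin 2) (Fin 2) L, A.det ≠ 0 ∧ A.mulVec ![1, 0] = z := by
  by_cases h0 : z 0 = 0
  · refine ⟨!![z 0, 1; z 1, 0], ?_, ?_⟩
    · have h1 : z 1 ≠ 0 := by
        intro h1
        refine hz (funext fun i => ?_)
        fin_cases i
        · exact h0
        · exact h1
      simpa using h1
    · ext i
      fin_cases i <;> simp
  · refine ⟨!![z 0, 0; z 1, 1], by simpa using h0, ?_⟩
    ext i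
    fin_cases i <;> simp

variable [IsAlgClosed L]

theorem exists_eval_eq_zero {n : ℕ} (hn : n ≠ 0) {P : MvPolynomial (Fin 2) L}
    (hP : P.IsHomogeneous n) : ∃ z : Fin 2 → L, z ≠ 0 ∧ MvPolynomial.eval z P = 0 := by
  by_cases h : (dehomogenize P).coeff n = 0
  · exact ⟨![1, 0], by simp, by rw [eval_one_zero hP, h]⟩
  · obtain ⟨t, ht⟩ := IsAlgClosed.exists_root (dehomogenize P) (fun h0 => by
      have := le_natDegree_of_ne_zero h
      rw [natDegree_eq_zero_iff_degree_le_zero.2 h0.le] at this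
      omega)
    exact ⟨![t, 1], by simp, by rw [← eval_dehomogenize]; exact ht⟩

theorem exists_pow_mul_eq_one {n : ℕ} (hn : n ≠ 0) {a : L} (ha : a ≠ 0) :
    ∃ μ : L, μ ≠ 0 ∧ μ ^ n * a = 1 := by
  obtain ⟨μ, hμ⟩ := IsAlgClosed.exists_pow_nat_eq a⁻¹ (Nat.pos_of_ne_zero hn)
  refine ⟨μ, ?_, by rw [hμ, inv_mul_cancel₀ ha]⟩
  rintro rfl
  rw [zero_pow hn] at hμ
  exact inv_ne_zero ha hμ.symm

/-- With `F(z) = a z`, the vector `μ z` is fixed once `μ ^ (d - 1) * a = 1`, which is solvable since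
`d ≥ 2`. -/
theorem exists_smul_fixed {d : ℕ} (hd : 2 ≤ d) {F : Fin 2 → MvPolynomial (Fin 2) L}
    (hF : ∀ i, (F i).IsHomogeneous d) {z : Fin 2 → L} {a : L} (ha : a ≠ 0)
    (h : (fun i => MvPolynomial.eval z (F i)) = a • z) :
    ∃ μ : L, μ ≠ 0 ∧ (fun i => MvPolynomial.eval (μ • z) (F i)) = μ • z := by
  obtain ⟨μ, hμ0, hμ⟩ := exists_pow_mul_eq_one (n := d - 1) (by omega) ha
  refine ⟨μ, hμ0, ?_⟩
  ext i
  have hi := congrFun h i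
  simp only [Pi.smul_apply, smul_eq_mul] at hi
  rw [eval_smul_of_isHomogeneous (hF i), hi, Pi.smul_apply, smul_eq_mul]
  obtain ⟨m, rfl⟩ : ∃ m, d = m + 1 := ⟨d - 1, by omega⟩
  rw [Nat.add_sub_cancel] at hμ
  rw [pow_succ]
  linear_combination μ * z i * hμ

theorem exists_fixed {d : ℕ} (hd : 2 ≤ d) {F : Fin 2 → MvPolynomial (Fin 2) L}
    (hF : ∀ i, (F i).IsHomogeneous d) (hres : pairRes d F ≠ 0) :
    ∃ z : Fin 2 → L, z ≠ 0 ∧ (fun i => MvPolynomial.eval z (F i)) = z := by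
  -- The zeros of this form of degree `d + 1` are the fixed points on the projective line.
  have hhom : (MvPolynomial.X 1 * F 0 - MvPolynomial.X 0 * F 1).IsHomogeneous (1 + d) :=
    ((MvPolynomial.isHomogeneous_X L 1).mul (hF 0)).sub
      ((MvPolynomial.isHomogeneous_X L 0).mul (hF 1))
  obtain ⟨z, hz, h⟩ := exists_eval_eq_zero (by omega) hhom
  simp only [map_sub, map_mul, MvPolynomial.eval_X, sub_eq_zero] at h
  have hex : ∃ a : L, (fun i => MvPolynomial.eval z (F i)) = a • z := by
    by_cases h0 : z 0 = 0
    · have h1 : z 1 ≠ 0 := by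
        intro h1
        refine hz (funext fun i => ?_)
        fin_cases i
        · exact h0
        · exact h1
      refine ⟨MvPolynomial.eval z (F 1) / z 1, funext <| Fin.forall_fin_two.2 ⟨?_, ?_⟩⟩
      · simp only [Pi.smul_apply, smul_eq_mul]
        field_simp
        linear_combination h
      · simp [h1]
    · refine ⟨MvPolynomial.eval z (F 0) / z 0, funext <| Fin.forall_fin_two.2 ⟨?_, ?_⟩⟩
      · simp [h0]
      · simp only [Pi.smul_apply, smul_eq_mul]
        field_simp
        linear_combination -h
  obtain ⟨a, ha⟩ := hex
  have ha0 : a ≠ 0 := by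
    rintro rfl
    exact hz (eq_zero_of_eval_eq_zero (by omega) hF hres fun i => by simpa using congrFun ha i)
  obtain ⟨μ, hμ, h2⟩ := exists_smul_fixed hd hF ha0 ha
  exact ⟨μ • z, smul_ne_zero hμ hz, h2⟩

/-- A pair of forms fixing the first basis vector has another fixed vector or another preimage of
that vector. -/
theorem exists_second {d : ℕ} (hd : 2 ≤ d) {F : Fin 2 → MvPolynomial (Fin 2) L}
    (hF : ∀ i, (F i).IsHomogeneous d) (hres : pairRes d F ≠ 0)
    (h0 : (fun i => MvPolynomial.eval ![1, 0] (F i)) = ![1, 0]) :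
    ∃ z : Fin 2 → L, z 1 ≠ 0 ∧ ((fun i => MvPolynomial.eval z (F i)) = ![1, 0] ∨
      (fun i => MvPolynomial.eval z (F i)) = z) := by
  have hd0 : d ≠ 0 := by omega
  have hne : ∀ t : L, MvPolynomial.eval ![t, 1] (F 0) ≠ 0 ∨
      MvPolynomial.eval ![t, 1] (F 1) ≠ 0 := by
    intro t
    by_contra! h
    have := eq_zero_of_eval_eq_zero hd0 hF hres (z := ![t, 1]) (Fin.forall_fin_two.2 h)
    simpa using congrFun this 1
  -- A root of the second component is a finite preimage of the point at infinity. Without a root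
  -- the map is a polynomial of degree `d ≥ 2` in the affine coordinate, so it has a finite fixed
  -- point.
  by_cases hr : ∃ t, (dehomogenize (F 1)).eval t = 0
  · obtain ⟨t, ht⟩ := hr
    rw [eval_dehomogenize] at ht
    have ha := (hne t).resolve_right (not_not.2 ht)
    obtain ⟨μ, hμ0, hμ⟩ := exists_pow_mul_eq_one hd0 ha
    refine ⟨μ • ![t, 1], by simpa using hμ0, Or.inl ?_⟩
    refine funext <| Fin.forall_fin_two.2 ⟨?_, ?_⟩
    · rw [eval_smul_of_isHomogeneous (hF 0), hμ]
      rfl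
    · rw [eval_smul_of_isHomogeneous (hF 1), ht, mul_zero]
      rfl
  · have hdeg : (dehomogenize (F 1)).degree = 0 := by
      by_contra h
      exact hr (IsAlgClosed.exists_root _ h)
    obtain ⟨b, hb⟩ : ∃ b, dehomogenize (F 1) = C b := ⟨_, eq_C_of_degree_eq_zero hdeg⟩
    have hb0 : b ≠ 0 := by
      rintro rfl
      exact hr ⟨0, by simp [hb]⟩
    have hlead : (dehomogenize (F 0)).coeff d = 1 := by
      rw [← eval_one_zero (hF 0)]
      exact congrFun h0 0
    have hcoef : (dehomogenize (F 0) - C b * X).coeff d = 1 := by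
      rw [coeff_sub, coeff_C_mul, coeff_X_of_ne_one (by omega), hlead, mul_zero, sub_zero]
    obtain ⟨t, ht⟩ := IsAlgClosed.exists_root (dehomogenize (F 0) - C b * X) (fun h => by
      have := le_natDegree_of_ne_zero (hcoef.trans_ne one_ne_zero)
      rw [natDegree_eq_zero_iff_degree_le_zero.2 h.le] at this
      omega)
    have ht' : MvPolynomial.eval ![t, 1] (F 0) = b * t := by
      rw [← eval_dehomogenize]
      simpa [sub_eq_zero] using ht
    have ht1 : MvPolynomial.eval ![t, 1] (F 1) = b := by
      rw [← eval_dehomogenize, hb, eval_C]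
    obtain ⟨μ, hμ0, hμ⟩ := exists_smul_fixed hd hF (z := ![t, 1]) hb0
      (funext <| Fin.forall_fin_two.2 ⟨by simpa using ht', by simpa using ht1⟩)
    exact ⟨μ • ![t, 1], by simpa using hμ0, Or.inr hμ⟩

theorem exists_isNormalized {d : ℕ} (hd : 2 ≤ d) {F : Fin 2 → MvPolynomial (Fin 2) L}
    (hF : ∀ i, (F i).IsHomogeneous d) (hres : pairRes d F ≠ 0) :
    ∃ N : GL (Fin 2) L, IsNormalized (sub N.1 N⁻¹.1 F) := by
  obtain ⟨z, hz, hfix⟩ := exists_fixed hd hF hres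
  obtain ⟨A, hA, hAz⟩ := exists_det_ne_zero_mulVec hz
  have hA' : IsUnit A.det := hA.isUnit
  have hAinv : A⁻¹.det ≠ 0 := by
    rw [Matrix.det_nonsing_inv, Ring.inverse_eq_inv']
    exact inv_ne_zero hA
  have h0 : (fun i => MvPolynomial.eval ![1, 0] (sub A A⁻¹ F i)) = ![1, 0] := by
    rw [eval_sub, hAz, hfix, ← hAz, Matrix.mulVec_mulVec, Matrix.nonsing_inv_mul _ hA',
      Matrix.one_mulVec]
  obtain ⟨y, hy, hfy⟩ := exists_second hd (isHomogeneous_sub A A⁻¹ hF) (by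
    rw [pairRes_sub hA hAinv hF]
    exact mul_ne_zero (mul_ne_zero (pow_ne_zero _ hA) (pow_ne_zero _ hAinv)) hres) h0
  -- This change of basis keeps the first basis vector and moves the second to `y`.
  set B : Matrix (Fin 2) (Fin 2) L := !![1, y 0; 0, y 1] with hBdef
  have hB : IsUnit B.det := by simpa [hBdef] using hy
  have hB0 : B.mulVec ![1, 0] = ![1, 0] := by
    ext i
    fin_cases i <;> simp [hBdef]
  have hB1 : B.mulVec ![0, 1] = y := by
    ext i
    fin_cases i <;> simp [hBdef]
  have hinv : ∀ u, B⁻¹.mulVec (B.mulVec u) = u := fun u => by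
    rw [Matrix.mulVec_mulVec, Matrix.nonsing_inv_mul _ hB, Matrix.one_mulVec]
  refine ⟨Matrix.GeneralLinearGroup.mk'' (A * B) (by rw [Matrix.det_mul]; exact hA'.mul hB), ?_⟩
  have hN : sub B B⁻¹ (sub A A⁻¹ F) = sub (A * B) (A * B)⁻¹ F := by
    rw [sub_sub, Matrix.mul_inv_rev]
  rw [Matrix.coe_units_inv]
  change IsNormalized (sub (A * B) (A * B)⁻¹ F)
  rw [← hN]
  constructor
  · rw [eval_sub, hB0, h0]
    nth_rw 1 [← hB0]
    exact hinv _
  · rw [eval_sub, hB1]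
    rcases hfy with h | h
    · left
      rw [h]
      nth_rw 1 [← hB0]
      exact hinv _
    · right
      rw [h]
      nth_rw 1 [← hB1]
      exact hinv _

end FixedPoints

/-! ### Integrality and extensions of absolute values -/

section Valuations

open Polynomial

/-- An absolute value is non-archimedean as soon as it is at most `1` on the natural numbers, and
these lie in the smaller field. -/
theorem isNonarchimedean_of_extends {K L : Type*} [Field K] [Field L] {v : AbsoluteValue K ℝ}
    (hv : IsNonarchimedean v) {w : AbsoluteValue L ℝ} (i : K →+* L) (h : ∀ x, w (i x) = v x) :
    IsNonarchimedean w := by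
  let := w.toNormedField
  have : IsUltrametricDist L := by
    refine IsUltrametricDist.isUltrametricDist_of_forall_norm_natCast_le_one fun n => ?_
    change w n ≤ 1
    rw [← map_natCast i, h]
    exact hv.apply_natCast_le_one
  exact IsUltrametricDist.isNonarchimedean_norm

/-- If `|x| > 1`, dividing the equation by the power of `x` one below its degree writes `x` as an
integral polynomial in the integral element `x⁻¹`. -/
theorem le_one_of_aeval_eq_zero {K L : Type*} [Field K] [Field L] [Algebra K L]
    {v : AbsoluteValue K ℝ} {w : AbsoluteValue L ℝ} (hw : IsNonarchimedean w)
    (h : ∀ x, w (algebraMap K L x) = v x) {p : K[X]} (hp : p.Monic) (hv : ∀ n, v (p.coeff n) ≤ 1)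
    {x : L} (hx : aeval x p = 0) : w x ≤ 1 := by
  by_contra hlt
  rw [not_le] at hlt
  have hx0 : x ≠ 0 := by
    rintro rfl
    rw [map_zero] at hlt
    linarith
  have hy : x⁻¹ ∈ integers hw := by
    rw [mem_integers, map_inv₀]
    exact inv_le_one_of_one_le₀ hlt.le
  rw [aeval_eq_sum_range, Finset.sum_range_succ, hp.coeff_natDegree, one_smul] at hx
  rcases Nat.eq_zero_or_pos p.natDegree with h0 | h0
  · rw [h0] at hx
    simp at hx
  have key : x = -∑ i ∈ Finset.range p.natDegree,
      algebraMap K L (p.coeff i) * x⁻¹ ^ (p.natDegree - 1 - i) := by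
    rw [eq_neg_iff_add_eq_zero]
    have h1 : x = x ^ p.natDegree * x⁻¹ ^ (p.natDegree - 1) := by
      obtain ⟨m, hm⟩ : ∃ m, p.natDegree = m + 1 := ⟨p.natDegree - 1, by omega⟩
      rw [hm, Nat.add_sub_cancel, pow_succ', mul_assoc, ← mul_pow, mul_inv_cancel₀ hx0, one_pow,
        mul_one]
    have h2 : ∀ i ∈ Finset.range p.natDegree, algebraMap K L (p.coeff i) *
        x⁻¹ ^ (p.natDegree - 1 - i) = (p.coeff i • x ^ i) * x⁻¹ ^ (p.natDegree - 1) := by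
      intro i hi
      rw [Finset.mem_range] at hi
      obtain ⟨m, hm⟩ : ∃ m, p.natDegree - 1 = i + m := ⟨p.natDegree - 1 - i, by omega⟩
      rw [hm, Nat.add_sub_cancel_left, pow_add, Algebra.smul_def, mul_assoc, ← mul_assoc (x ^ i),
        ← mul_pow, mul_inv_cancel₀ hx0, one_pow, one_mul]
    nth_rw 1 [h1]
    rw [Finset.sum_congr rfl h2, ← Finset.sum_mul, ← add_mul, add_comm, hx, zero_mul]
  have : x ∈ integers hw := by
    rw [key]
    refine Subring.neg_mem _ (Subring.sum_mem _ fun i _ => Subring.mul_mem _ ?_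
      (Subring.pow_mem _ hy _))
    rw [mem_integers, h]
    exact hv i
  exact absurd this (not_le.2 hlt)

/-- The unit constant coefficient is, up to sign, `x` times an integral element. -/
theorem one_le_of_aeval_eq_zero {K L : Type*} [Field K] [Field L] [Algebra K L]
    {v : AbsoluteValue K ℝ} {w : AbsoluteValue L ℝ} (hw : IsNonarchimedean w)
    (h : ∀ x, w (algebraMap K L x) = v x) {p : K[X]} (hv : ∀ n, v (p.coeff n) ≤ 1)
    (h0 : v (p.coeff 0) = 1) {x : L} (hx : aeval x p = 0) (hx1 : w x ≤ 1) : 1 ≤ w x := by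
  have h1 := congrArg (aeval x) p.divX_mul_X_add
  simp only [map_add, map_mul, aeval_X, aeval_C] at h1
  rw [hx] at h1
  have h2 : w (aeval x p.divX) ≤ 1 := by
    rw [← mem_integers (hw := hw), aeval_eq_sum_range]
    refine Subring.sum_mem _ fun i _ => ?_
    rw [Algebra.smul_def]
    refine Subring.mul_mem _ ?_ (Subring.pow_mem _ hx1 _)
    rw [mem_integers, h, coeff_divX]
    exact hv _
  have h3 : w (algebraMap K L (p.coeff 0)) = w (aeval x p.divX) * w x := by
    rw [← map_mul, ← w.map_neg, neg_eq_of_add_eq_zero_left h1]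
  rw [h, h0] at h3
  rw [h3]
  exact mul_le_of_le_one_left (w.nonneg _) h2

/-- Every root of the minimal polynomial is some `σ x`, so over `C` the polynomial is a product of
linear factors with integral coefficients. -/
theorem coeff_minpoly_le_one {K K' C : Type*} [Field K] [Field K'] [Field C] [Algebra K K']
    [Algebra.IsAlgebraic K K'] [Algebra K C] [IsAlgClosed C] {v : AbsoluteValue K ℝ}
    {w : AbsoluteValue C ℝ} (hw : IsNonarchimedean w) (h : ∀ x, w (algebraMap K C x) = v x) {x : K'}
    (hx : ∀ σ : K' →ₐ[K] C, w (σ x) ≤ 1) (n : ℕ) : v ((minpoly K x).coeff n) ≤ 1 := by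
  set p := minpoly K x with hp
  have hmonic : (p.map (algebraMap K C)).Monic :=
    (minpoly.monic (Algebra.IsIntegral.isIntegral x)).map _
  have hroot : ∀ r ∈ (p.map (algebraMap K C)).roots, w r ≤ 1 := by
    intro r hr
    have : r ∈ (minpoly K x).rootSet C := by
      rw [mem_rootSet']
      refine ⟨hmonic.ne_zero, ?_⟩
      have := isRoot_of_mem_roots hr
      rwa [IsRoot, eval_map_algebraMap] at this
    rw [← Algebra.IsAlgebraic.range_eval_eq_rootSet_minpoly] at this
    obtain ⟨σ, rfl⟩ := this
    exact hx σ
  have hmem : p.map (algebraMap K C) ∈ Polynomial.lifts (integers hw).subtype := by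
    rw [(IsAlgClosed.splits _).eq_prod_roots_of_monic hmonic]
    refine Subsemiring.multiset_prod_mem _ _ fun q hq => ?_
    obtain ⟨r, hr, rfl⟩ := Multiset.mem_map.1 hq
    rw [Polynomial.mem_lifts]
    exact ⟨X - Polynomial.C ⟨r, hroot r hr⟩, by simp⟩
  obtain ⟨y, hy⟩ := (Polynomial.lifts_iff_coeff_lifts _).1 hmem n
  rw [coeff_map] at hy
  rw [← h, ← hy]
  exact y.2

end Valuations

/-! ### The product formula, places of finite extensions and constants -/

section Places

variable {K : Type u} [Field K]

/-- A product of factors at most `1` that equals `1` has no factor below `1`. -/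
theorem eq_one_of_forall_le_one {MK : Set (AbsoluteValue K ℝ)} (hK : IsFunctionField MK) {x : K}
    (hx : x ≠ 0) (h : ∀ v ∈ MK, v x ≤ 1) {v : AbsoluteValue K ℝ} (hv : v ∈ MK) : v x = 1 := by
  classical
  have hfin : (Function.mulSupport fun v : MK => v.1 x).Finite := by
    refine Set.Finite.of_finite_image (f := Subtype.val) ((hK.finite_ne_one x hx).subset ?_)
      Subtype.val_injective.injOn
    rintro _ ⟨v, hv, rfl⟩
    exact ⟨v.2, hv⟩
  have hprod := hK.product_formula x hx
  rw [finprod_eq_prod _ hfin] at hprod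
  by_contra hne
  have hmem : (⟨v, hv⟩ : MK) ∈ hfin.toFinset := by simpa using hne
  rw [← Finset.mul_prod_erase _ _ hmem] at hprod
  have h1 : ∏ u ∈ hfin.toFinset.erase ⟨v, hv⟩, u.1 x ≤ 1 :=
    Finset.prod_le_one (fun u _ => u.1.nonneg _) fun u _ => h u.1 u.2
  have h2 : (1 : ℝ) ≤ v x := by
    rw [← hprod]
    exact mul_le_of_le_one_right (v.nonneg _) h1
  exact hne (le_antisymm (h v hv) h2)

/-- `x` is integral over the field of constants: its minimal polynomial has constant
coefficients. -/
def HasConstantMinpoly (MK : Set (AbsoluteValue K ℝ)) {K' : Type*} [Field K'] [Algebra K K']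
    (x : K') : Prop :=
  ∀ v ∈ MK, ∀ n, v ((minpoly K x).coeff n) ≤ 1

namespace HasConstantMinpoly

variable {MK : Set (AbsoluteValue K ℝ)} {K' : Type*} [Field K'] [Algebra K K']
  [Algebra.IsAlgebraic K K'] {x : K'}

theorem le_one (h : HasConstantMinpoly MK x) {v : AbsoluteValue K ℝ} (hv : v ∈ MK)
    {w : AbsoluteValue K' ℝ} (hw : IsNonarchimedean w) (hvw : ∀ y, w (algebraMap K K' y) = v y) :
    w x ≤ 1 :=
  le_one_of_aeval_eq_zero hw hvw (minpoly.monic (Algebra.IsIntegral.isIntegral x)) (h v hv)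
    (minpoly.aeval K x)

/-- The product formula on `K` makes the non-zero constant coefficient of the minimal polynomial a
unit at `v`. No product formula on `K'` is needed. -/
theorem eq_one (hK : IsFunctionField MK) (h : HasConstantMinpoly MK x) (hx : x ≠ 0)
    {v : AbsoluteValue K ℝ} (hv : v ∈ MK)
    {w : AbsoluteValue K' ℝ} (hw : IsNonarchimedean w) (hvw : ∀ y, w (algebraMap K K' y) = v y) :
    w x = 1 := by
  have h1 := h.le_one hv hw hvw
  refine le_antisymm h1 (one_le_of_aeval_eq_zero hw hvw (h v hv) ?_ (minpoly.aeval K x) h1)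
  exact eq_one_of_forall_le_one hK
    (minpoly.coeff_zero_ne_zero (Algebra.IsIntegral.isIntegral x) hx) (fun u hu => h u hu 0) hv

end HasConstantMinpoly

theorem isNonarchimedean_completionAbs {v : AbsoluteValue K ℝ} (hv : IsNonarchimedean v) :
    IsNonarchimedean (completionAbs v) :=
  isNonarchimedean_of_extends hv (toCompletion v) (completionAbs_toCompletion v)

/-- The structure of a complete non-archimedean field on the completion. -/
abbrev completionField (v : AbsoluteValue K ℝ) (hv : v.IsNontrivial) :
    NontriviallyNormedField v.Completion :=
  NontriviallyNormedField.ofNormNeOne <| by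
    obtain ⟨x, hx, hx1⟩ := hv
    refine ⟨toCompletion v x, (map_ne_zero _).2 hx, ?_⟩
    have := completionAbs_toCompletion v x
    exact fun h => hx1 (this.symm.trans h)

/-- The extension is the spectral norm. Over a complete field an absolute value extends to an
algebraic extension in only one way, which makes every embedding `τ` isometric. -/
theorem exists_absoluteValue_algebraicClosure {v : AbsoluteValue K ℝ} (hv : v.IsNontrivial)
    (hna : IsNonarchimedean v) :
    ∃ w : AbsoluteValue (AlgebraicClosure v.Completion) ℝ, IsNonarchimedean w ∧
      (∀ x, w (algebraMap v.Completion _ x) = completionAbs v x) ∧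
      ∀ (L' : Type u) [Field L'] [Algebra v.Completion L'] [FiniteDimensional v.Completion L']
        (w' : AbsoluteValue L' ℝ),
        (∀ x, w' (algebraMap v.Completion L' x) = completionAbs v x) →
        ∀ (τ : L' →ₐ[v.Completion] AlgebraicClosure v.Completion) (x : L'), w (τ x) = w' x := by
  let := completionField v hv
  have hult : IsUltrametricDist v.Completion :=
    IsUltrametricDist.isUltrametricDist_of_isNonarchimedean_norm
      (isNonarchimedean_completionAbs hna)
  let := spectralNorm.normedField v.Completion (AlgebraicClosure v.Completion)
  let w : AbsoluteValue (AlgebraicClosure v.Completion) ℝ := NormedField.toAbsoluteValue _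
  have hw : ∀ x, w (algebraMap v.Completion _ x) = completionAbs v x := fun x =>
    spectralNorm_extends x
  refine ⟨w, isNonarchimedean_of_extends (isNonarchimedean_completionAbs hna) _ hw, hw, ?_⟩
  intro L' _ _ _ w' hw' τ x
  have h1 := spectralNorm_unique_field_norm_ext (K := v.Completion) (f := w') hw' x
  have h2 := spectralNorm_unique_field_norm_ext (K := v.Completion)
    (f := w.comp τ.toRingHom.injective) (fun y => by
      change w (τ (algebraMap _ _ y)) = _
      rw [τ.commutes]
      exact hw y) x
  exact h2.trans h1.symm

/-- An algebraically closed valued extension of the completion in which every finite extension of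
the completion embeds isometrically. -/
theorem exists_isAlgClosed_extension {v : AbsoluteValue K ℝ} (hv : v.IsNontrivial)
    (hna : IsNonarchimedean v) :
    ∃ (C : Type u) (_ : Field C) (_ : IsAlgClosed C) (w : AbsoluteValue C ℝ)
      (j : v.Completion →+* C), IsNonarchimedean w ∧ (∀ x, w (j (toCompletion v x)) = v x) ∧
      ∀ (L' : Type u) [Field L'] [Algebra v.Completion L'] [FiniteDimensional v.Completion L']
        (w' : AbsoluteValue L' ℝ),
        (∀ x, w' (algebraMap v.Completion L' x) = completionAbs v x) →
        ∃ τ : L' →+* C, τ.comp (algebraMap v.Completion L') = j ∧ ∀ x, w (τ x) = w' x := by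
  obtain ⟨w, hw, hext, huniq⟩ := exists_absoluteValue_algebraicClosure hv hna
  refine ⟨AlgebraicClosure v.Completion, inferInstance, inferInstance, w, algebraMap _ _, hw,
    fun x => (hext _).trans (completionAbs_toCompletion v x), ?_⟩
  intro L' _ _ _ w' hw'
  exact ⟨(IsAlgClosed.lift : L' →ₐ[v.Completion] AlgebraicClosure v.Completion).toRingHom,
    AlgHom.comp_algebraMap _, huniq L' w' hw' _⟩

/-- A finite extension of `K` embeds into a finite valued extension of the completion. -/
theorem exists_finite_extension {v : AbsoluteValue K ℝ} (hv : v.IsNontrivial)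
    (hna : IsNonarchimedean v) (K' : Type u) [Field K'] [Algebra K K'] [FiniteDimensional K K'] :
    ∃ (L' : Type u) (_ : Field L') (_ : Algebra v.Completion L') (w' : AbsoluteValue L' ℝ)
      (i : K' →+* L'), FiniteDimensional v.Completion L' ∧
      (∀ x, w' (algebraMap v.Completion L' x) = completionAbs v x) ∧
      i.comp (algebraMap K K') = (algebraMap v.Completion L').comp (toCompletion v) := by
  obtain ⟨w, hw, hext, -⟩ := exists_absoluteValue_algebraicClosure hv hna
  set C := AlgebraicClosure v.Completion with hC
  obtain ⟨i, hi⟩ : ∃ i : K' →+* C,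
      i.comp (algebraMap K K') = (algebraMap v.Completion C).comp (toCompletion v) := by
    let : Algebra K C := ((algebraMap v.Completion C).comp (toCompletion v)).toAlgebra
    exact ⟨(IsAlgClosed.lift : K' →ₐ[K] C).toRingHom, AlgHom.comp_algebraMap _⟩
  -- The images of a `K`-basis of `K'` generate, over the completion, a finite extension that
  -- contains all of `K'`.
  let b := Module.finBasis K K'
  let E : IntermediateField v.Completion C :=
    IntermediateField.adjoin v.Completion (Set.range fun n => i (b n))
  have hE : FiniteDimensional v.Completion E :=
    IntermediateField.finiteDimensional_adjoin fun x _ => Algebra.IsIntegral.isIntegral x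
  have hmem : ∀ x, i x ∈ E := by
    intro x
    rw [← b.sum_repr x, map_sum]
    refine sum_mem fun n _ => ?_
    rw [Algebra.smul_def, map_mul]
    refine mul_mem ?_ (IntermediateField.subset_adjoin _ _ ⟨n, rfl⟩)
    have := DFunLike.congr_fun hi (b.repr x n)
    simp only [RingHom.comp_apply] at this
    rw [this]
    exact E.algebraMap_mem _
  refine ⟨E, inferInstance, inferInstance, w.comp (f := algebraMap E C) (algebraMap E C).injective,
    i.codRestrict E hmem, hE, fun x => hext x, ?_⟩
  ext x
  exact DFunLike.congr_fun hi x

/-- Pulling `w` back along any `K`-embedding of `K'` into `C` gives a place above `v`, so a constant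
has all its conjugates bounded by `1`. -/
theorem mem_constants_iff {MK : Set (AbsoluteValue K ℝ)} (hK : IsFunctionField MK)
    {K' : Type u} [Field K'] [Algebra K K'] [Algebra.IsAlgebraic K K'] {x : K'} :
    x ∈ constants (extendedPlaces MK K') ↔ HasConstantMinpoly MK x := by
  constructor
  · intro h v hv
    obtain ⟨C, _, _, w, j, hw, hext, -⟩ :=
      exists_isAlgClosed_extension (hK.nontrivial v hv) (hK.nonarchimedean v hv)
    let : Algebra K C := (j.comp (toCompletion v)).toAlgebra
    refine coeff_minpoly_le_one (C := C) hw hext fun σ => ?_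
    refine h (w.comp (f := σ.toRingHom) σ.toRingHom.injective) ⟨v, hv, fun y => ?_⟩
    change w (σ (algebraMap K K' y)) = v y
    rw [σ.commutes]
    exact hext y
  · rintro h w ⟨v, hv, hvw⟩
    exact h.le_one hv (isNonarchimedean_of_extends (hK.nonarchimedean v hv) _ hvw) hvw

theorem eq_one_of_mem_constants {MK : Set (AbsoluteValue K ℝ)} (hK : IsFunctionField MK)
    {K' : Type u} [Field K'] [Algebra K K'] [Algebra.IsAlgebraic K K'] {x : K'}
    (hx : x ∈ constants (extendedPlaces MK K')) (h0 : x ≠ 0) {w : AbsoluteValue K' ℝ}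
    (hw : w ∈ extendedPlaces MK K') : w x = 1 := by
  obtain ⟨v, hv, hvw⟩ := hw
  exact ((mem_constants_iff hK).1 hx).eq_one hK h0 hv
    (isNonarchimedean_of_extends (hK.nonarchimedean v hv) _ hvw) hvw

/-- The field of constants of a finite extension. -/
def constantField {MK : Set (AbsoluteValue K ℝ)} (hK : IsFunctionField MK)
    (K' : Type u) [Field K'] [Algebra K K'] [Algebra.IsAlgebraic K K'] : Subfield K' where
  carrier := constants (extendedPlaces MK K')
  mul_mem' {a b} ha hb w hw := by
    rw [map_mul]
    exact mul_le_one₀ (ha w hw) (w.nonneg b) (hb w hw)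
  one_mem' w hw := by simp
  add_mem' {a b} ha hb w hw := by
    obtain ⟨v, hv, hvw⟩ := hw
    exact (isNonarchimedean_of_extends (hK.nonarchimedean v hv) _ hvw a b).trans
      (max_le (ha w ⟨v, hv, hvw⟩) (hb w ⟨v, hv, hvw⟩))
  zero_mem' w hw := by simp
  neg_mem' {a} ha w hw := by simpa using ha w hw
  inv_mem' a ha w hw := by
    by_cases h0 : a = 0
    · simp [h0]
    · rw [map_inv₀, eq_one_of_mem_constants hK ha h0 hw, inv_one]

end Places

/-! ### The two implications -/

section Main

open Polynomial

variable {K : Type u} [Field K]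

theorem eval_map_comp {L : Type*} [Field L] (f : K →+* L) (P : MvPolynomial (Fin 2) K)
    (z : Fin 2 → K) :
    MvPolynomial.eval (f ∘ z) (MvPolynomial.map f P) = f (MvPolynomial.eval z P) := by
  rw [MvPolynomial.eval_map, MvPolynomial.eval₂_comp]

theorem isNormalized_map_iff {L : Type*} [Field L] (f : K →+* L)
    {F : Fin 2 → MvPolynomial (Fin 2) K} :
    IsNormalized (fun i => MvPolynomial.map f (F i)) ↔ IsNormalized F := by
  have hv : ∀ a b : K, f ∘ ![a, b] = ![f a, f b] := by
    intro a b
    ext i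
    fin_cases i <;> rfl
  have key : ∀ z u : Fin 2 → K,
      ((fun i => MvPolynomial.eval (f ∘ z) (MvPolynomial.map f (F i))) = f ∘ u ↔
        (fun i => MvPolynomial.eval z (F i)) = u) := by
    intro z u
    rw [← f.injective.comp_left.eq_iff (b := u)]
    simp only [eval_map_comp]
    rfl
  have h0 : f ∘ ![1, 0] = ![1, 0] := by simp [hv]
  have h1 : f ∘ ![0, 1] = ![0, 1] := by simp [hv]
  have k0 := key ![1, 0] ![1, 0]
  have k1 := key ![0, 1] ![1, 0]
  have k2 := key ![0, 1] ![0, 1]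
  rw [h0] at k0
  rw [h1, h0] at k1
  rw [h1] at k2
  exact ⟨fun h => ⟨k0.1 h.fst, h.snd.imp k1.1 k2.1⟩, fun h => ⟨k0.2 h.fst, h.snd.imp k1.2 k2.2⟩⟩

theorem coe_map_inv {L : Type*} [Field L] (f : K →+* L) (M : GL (Fin 2) K) :
    (Matrix.GeneralLinearGroup.map f M)⁻¹.1 = M⁻¹.1.map f := by
  rw [← map_inv]
  rfl

/-- Conjugation of a pair of forms commutes with extension of scalars. -/
theorem map_conj_forms {L : Type*} [Field L] (f : K →+* L) (M : GL (Fin 2) K)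
    (F : Fin 2 → MvPolynomial (Fin 2) K) :
    (fun i => MvPolynomial.map f (sub M.1 M⁻¹.1 F i)) =
      sub (Matrix.GeneralLinearGroup.map f M).1 (Matrix.GeneralLinearGroup.map f M)⁻¹.1
        (fun i => MvPolynomial.map f (F i)) := by
  rw [sub_map, coe_map_inv]
  rfl

/-- The normalizing matrix over the algebraic closure has four entries, and adjoining them gives a
finite extension. -/
theorem exists_finite_isNormalized {d : ℕ} (hd : 2 ≤ d) {F : Fin 2 → MvPolynomial (Fin 2) K}
    (hF : ∀ i, (F i).IsHomogeneous d) (hres : pairRes d F ≠ 0) :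
    ∃ (K' : Type u) (_ : Field K') (_ : Algebra K K') (N : GL (Fin 2) K'),
      FiniteDimensional K K' ∧
      IsNormalized (sub N.1 N⁻¹.1 (fun i => MvPolynomial.map (algebraMap K K') (F i))) := by
  obtain ⟨N, hN⟩ := exists_isNormalized hd (L := AlgebraicClosure K)
    (F := fun i => MvPolynomial.map (algebraMap K (AlgebraicClosure K)) (F i))
    (fun i => (hF i).map _) (by rw [pairRes_map]; exact (_root_.map_ne_zero _).2 hres)
  let E : IntermediateField K (AlgebraicClosure K) :=
    IntermediateField.adjoin K (Set.range fun p : Fin 2 × Fin 2 => N.1 p.1 p.2)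
  have hE : FiniteDimensional K E :=
    IntermediateField.finiteDimensional_adjoin fun x _ => Algebra.IsIntegral.isIntegral x
  let A : Matrix (Fin 2) (Fin 2) E := Matrix.of fun i j =>
    ⟨N.1 i j, IntermediateField.subset_adjoin K _ ⟨(i, j), rfl⟩⟩
  have hA : A.map (algebraMap E (AlgebraicClosure K)) = N.1 := rfl
  have hdet : IsUnit A.det := by
    rw [isUnit_iff_ne_zero]
    intro h0
    have h1 := RingHom.map_det (algebraMap E (AlgebraicClosure K)) A
    rw [h0, map_zero] at h1
    exact N.det.ne_zero h1.symm
  let N' : GL (Fin 2) E := Matrix.GeneralLinearGroup.mk'' A hdet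
  have hN' : Matrix.GeneralLinearGroup.map (algebraMap E (AlgebraicClosure K)) N' = N :=
    Units.ext hA
  refine ⟨E, inferInstance, inferInstance, N', hE, ?_⟩
  rw [← isNormalized_map_iff (algebraMap E (AlgebraicClosure K)), map_conj_forms, hN']
  simpa only [MvPolynomial.map_map, ← IsScalarTower.algebraMap_eq] using hN

/-- At a place of potentially good reduction, the conjugates of a normalized lifting of `φ` have
resultant of absolute value at most `1`, and integral coefficients if equality holds. -/
theorem good_of_potentiallyGood {v : AbsoluteValue K ℝ} {φ : RatFunc K} {d : ℕ} (hd : 2 ≤ d)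
    {F : Fin 2 → MvPolynomial (Fin 2) K} (hF : IsLift d φ F)
    (hgood : HasPotentiallyGoodReduction (completionAbs v) (baseChange (toCompletion v) φ))
    {C : Type u} [Field C] {w : AbsoluteValue C ℝ} {j : v.Completion →+* C}
    (hw : IsNonarchimedean w)
    (hemb : ∀ (L' : Type u) [Field L'] [Algebra v.Completion L'] [FiniteDimensional v.Completion L']
        (w' : AbsoluteValue L' ℝ),
        (∀ x, w' (algebraMap v.Completion L' x) = completionAbs v x) →
        ∃ τ : L' →+* C, τ.comp (algebraMap v.Completion L') = j ∧ ∀ x, w (τ x) = w' x)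
    {K' : Type u} [Field K'] [Algebra K K'] (N : GL (Fin 2) K')
    (hN : IsNormalized (sub N.1 N⁻¹.1 (fun i => MvPolynomial.map (algebraMap K K') (F i))))
    (σ : K' →+* C) (hσ : σ.comp (algebraMap K K') = j.comp (toCompletion v)) :
    w (σ (pairRes d (sub N.1 N⁻¹.1 (fun i => MvPolynomial.map (algebraMap K K') (F i))))) ≤ 1 ∧
    (w (σ (pairRes d (sub N.1 N⁻¹.1 (fun i => MvPolynomial.map (algebraMap K K') (F i))))) = 1 →
      ∀ i, IsIntegralForm w (MvPolynomial.map σ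
        (sub N.1 N⁻¹.1 (fun i => MvPolynomial.map (algebraMap K K') (F i)) i))) := by
  have hd0 : d ≠ 0 := by omega
  obtain ⟨L', _, _, w', _, hw', M, H₁, H₂, hlift, hi₁, hi₂, hres⟩ := hgood
  obtain ⟨τ, hτ, hτw⟩ := hemb L' w' hw'
  have hφ := ((hF.baseChange hd0 (toCompletion v)).baseChange hd0
    (algebraMap v.Completion L')).conj hd0 M
  have hlift' := (isHomogeneousLifting_iff (F := ![H₁, H₂])).1 hlift
  rw [hφ.degree_eq hd0] at hlift' hres
  -- The good lifting can differ from the conjugate of `F` by `M` only by a scalar.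
  obtain ⟨c, hc, hH⟩ := hφ.unique hlift' hd0
  set G := sub N.1 N⁻¹.1 (fun i => MvPolynomial.map (algebraMap K K') (F i)) with hG
  set FC : Fin 2 → MvPolynomial (Fin 2) C :=
    fun i => MvPolynomial.map (j.comp (toCompletion v)) (F i) with hFC
  set S := Matrix.GeneralLinearGroup.map σ N with hS
  set T := Matrix.GeneralLinearGroup.map τ M with hT
  have hGC : (fun i => MvPolynomial.map σ (G i)) = sub S.1 S⁻¹.1 FC := by
    rw [hG, map_conj_forms]
    simp only [MvPolynomial.map_map, hσ, hFC]
    rfl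
  have hHC : (fun i => MvPolynomial.map τ (![H₁, H₂] i)) =
      fun i => MvPolynomial.C (τ c) * sub T.1 T⁻¹.1 FC i := by
    have h1 := map_conj_forms τ M (fun i => MvPolynomial.map (algebraMap v.Completion L')
      (MvPolynomial.map (toCompletion v) (F i)))
    simp only [MvPolynomial.map_map, ← RingHom.comp_assoc, hτ] at h1
    rw [hH]
    ext1 i
    rw [map_mul, MvPolynomial.map_C]
    congr 1
    simp only [MvPolynomial.map_map]
    exact congrFun h1 i
  -- Inside `C` both pairs are conjugates of the same `F`, so the good one is the conjugate of the
  -- normalized one by `S⁻¹ T`.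
  have hsub : sub T.1 T⁻¹.1 FC =
      sub (S⁻¹ * T).1 (T⁻¹ * S).1 (fun i => MvPolynomial.map σ (G i)) := by
    rw [hGC, sub_sub]
    congr 1
    · rw [← Units.val_mul, mul_inv_cancel_left]
    · rw [← Units.val_mul, mul_assoc, mul_inv_cancel, mul_one]
  rw [hsub] at hHC
  have hmain := IsNormalized.good hw hd (F := fun i => MvPolynomial.map σ (G i))
    (fun i => (isHomogeneous_sub _ _ (fun i => (hF.hom i).map _) i).map σ)
    ((isNormalized_map_iff σ).2 hN) (A := (S⁻¹ * T).1) (B := (T⁻¹ * S).1) (c := τ c)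
    (by rw [← Units.val_mul, mul_assoc, mul_inv_cancel_left, inv_mul_cancel, Units.val_one])
    (fun i => by
      rw [← congrFun hHC i]
      intro m
      rw [MvPolynomial.coeff_map, hτw]
      fin_cases i
      · exact hi₁ m
      · exact hi₂ m)
    (by
      rw [← hHC, pairRes_map, hτw]
      exact hres)
  rwa [pairRes_map] at hmain

theorem isIsotrivial_of_potentiallyGood {MK : Set (AbsoluteValue K ℝ)} (hK : IsFunctionField MK)
    {φ : RatFunc K} (hφ : 2 ≤ degree φ)
    (h : ∀ v ∈ MK, HasPotentiallyGoodReduction (completionAbs v) (baseChange (toCompletion v) φ)) :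
    IsIsotrivial MK φ := by
  have hd0 : degree φ ≠ 0 := by omega
  obtain ⟨F, hF⟩ := exists_isLift φ
  obtain ⟨K', _, _, N, _, hN⟩ := exists_finite_isNormalized hφ hF.hom hF.res_ne_zero
  have hG := (hF.baseChange hd0 (algebraMap K K')).conj hd0 N
  set G := sub N.1 N⁻¹.1 (fun i => MvPolynomial.map (algebraMap K K') (F i)) with hGdef
  have hres : HasConstantMinpoly MK (pairRes (degree φ) G) := by
    intro v hv
    obtain ⟨C, _, _, w, j, hw, hext, hemb⟩ :=
      exists_isAlgClosed_extension (hK.nontrivial v hv) (hK.nonarchimedean v hv)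
    let : Algebra K C := (j.comp (toCompletion v)).toAlgebra
    exact coeff_minpoly_le_one (C := C) hw hext fun σ =>
      (good_of_potentiallyGood hφ hF (h v hv) hw hemb N hN σ.toRingHom σ.comp_algebraMap).1
  have hcoeff : ∀ i m, HasConstantMinpoly MK ((G i).coeff m) := by
    intro i m v hv
    obtain ⟨C, _, _, w, j, hw, hext, hemb⟩ :=
      exists_isAlgClosed_extension (hK.nontrivial v hv) (hK.nonarchimedean v hv)
    let : Algebra K C := (j.comp (toCompletion v)).toAlgebra
    refine coeff_minpoly_le_one (C := C) hw hext fun σ => ?_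
    -- The bound on the resultant at all places, already proved, enters here through the product
    -- formula.
    have hσ : w (σ (pairRes (degree φ) G)) = 1 :=
      hres.eq_one hK hG.res_ne_zero hv (w := w.comp (f := σ.toRingHom) σ.toRingHom.injective)
        (fun a b => by
          change w (σ (a + b)) ≤ max (w (σ a)) (w (σ b))
          rw [map_add]
          exact hw _ _) fun y => by
          change w (σ (algebraMap K K' y)) = v y
          rw [σ.commutes]
          exact hext y
    have := (good_of_potentiallyGood hφ hF (h v hv) hw hemb N hN σ.toRingHom
      σ.comp_algebraMap).2 hσ i m
    rwa [MvPolynomial.coeff_map] at this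
  have hdeh : ∀ i n, (dehomogenize (G i)).coeff n ∈ constants (extendedPlaces MK K') := by
    intro i n
    rcases exists_coeff_dehomogenize_eq (hG.hom i) n with h0 | ⟨m, hm⟩
    · rw [h0]
      exact (constantField hK K').zero_mem
    · rw [hm]
      exact (mem_constants_iff hK).2 (hcoeff i m)
  exact ⟨K', inferInstance, inferInstance, inferInstance, N, dehomogenize (G 0),
    dehomogenize (G 1), hG.snd_ne_zero hd0, hdeh 0, hdeh 1, hG.eq_div⟩

/-- Descending `φ` to a rational map over `k` puts the forms and their non-zero resultant in `k`. -/
theorem exists_constant_lift {k : Subfield K} {φ : RatFunc K} (h : IsDefinedOver (k : Set K) φ) :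
    ∃ F : Fin 2 → MvPolynomial (Fin 2) k,
      pairRes (degree φ) F ≠ 0 ∧
      (degree φ ≠ 0 → IsLift (degree φ) φ fun i => MvPolynomial.map k.subtype (F i)) := by
  obtain ⟨P, Q, hQ, hP, hQk, rfl⟩ := h
  have hl : ∀ P : K[X], (∀ i, P.coeff i ∈ (k : Set K)) → ∃ p : k[X], p.map k.subtype = P := by
    intro P hP
    rw [← Polynomial.mem_lifts, Polynomial.lifts_iff_coeff_lifts]
    exact fun n => ⟨⟨_, hP n⟩, rfl⟩
  obtain ⟨p, rfl⟩ := hl P hP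
  obtain ⟨q, rfl⟩ := hl Q hQk
  have hq : q ≠ 0 := by
    rintro rfl
    simp at hQ
  rw [← baseChange_div k.subtype hq, degree_baseChange]
  obtain ⟨F, hF⟩ := exists_isLift (algebraMap k[X] (RatFunc k) p / algebraMap k[X] (RatFunc k) q)
  exact ⟨F, hF.res_ne_zero, fun hd => hF.baseChange hd _⟩

theorem potentiallyGood_of_isIsotrivial {MK : Set (AbsoluteValue K ℝ)} (hK : IsFunctionField MK)
    {φ : RatFunc K} (hφ : 2 ≤ degree φ) (h : IsIsotrivial MK φ) {v : AbsoluteValue K ℝ}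
    (hv : v ∈ MK) :
    HasPotentiallyGoodReduction (completionAbs v) (baseChange (toCompletion v) φ) := by
  have hd0 : degree φ ≠ 0 := by omega
  obtain ⟨K', _, _, _, M, hM⟩ := h
  obtain ⟨L', _, _, w', i, _, hw', hi⟩ :=
    exists_finite_extension (hK.nontrivial v hv) (hK.nonarchimedean v hv) K'
  have hwi : w'.comp i.injective ∈ extendedPlaces MK K' := by
    refine ⟨v, hv, fun x => ?_⟩
    have := DFunLike.congr_fun hi x
    simp only [RingHom.comp_apply] at this
    change w' (i (algebraMap K K' x)) = v x
    rw [this, hw', completionAbs_toCompletion]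
  obtain ⟨F₀, hF₀⟩ := exists_isLift φ
  have hlift := (hF₀.baseChange hd0 (algebraMap K K')).conj hd0 M
  obtain ⟨F, hres, hF⟩ := exists_constant_lift (k := constantField hK K') hM
  rw [hlift.degree_eq hd0] at hres hF
  -- The constant lifting is a scalar multiple of the conjugate by `M`, so its image in `L'`
  -- represents the conjugate of `φ` by the image of `M`.
  obtain ⟨c, hc, hcF⟩ := hlift.unique (hF hd0) hd0
  set M' := Matrix.GeneralLinearGroup.map i M with hM'
  have hlift' := (((hF₀.baseChange hd0 (toCompletion v)).baseChange hd0
    (algebraMap v.Completion L')).conj hd0 M').smul ((_root_.map_ne_zero i).2 hc)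
  have hFL : (fun n => MvPolynomial.C (i c) * sub M'.1 M'⁻¹.1 (fun n =>
      MvPolynomial.map (algebraMap v.Completion L') (MvPolynomial.map (toCompletion v) (F₀ n))) n) =
      fun n => MvPolynomial.map (i.comp (constantField hK K').subtype) (F n) := by
    have h1 := map_conj_forms i M (fun n => MvPolynomial.map (algebraMap K K') (F₀ n))
    simp only [MvPolynomial.map_map, hi] at h1
    ext1 n
    rw [← MvPolynomial.map_map, congrFun hcF n, map_mul, MvPolynomial.map_C]
    congr 1
    simp only [MvPolynomial.map_map]
    exact (congrFun h1 n).symm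
  rw [hFL] at hlift'
  have hdeg := hlift'.degree_eq hd0
  rw [← hdeg] at hlift'
  have hone : ∀ x : constantField hK K', w' (i x) ≤ 1 := fun x => x.2 _ hwi
  refine ⟨L', inferInstance, inferInstance, w', inferInstance, hw', M', _, _,
    isHomogeneousLifting_iff.2 hlift', fun m => ?_, fun m => ?_, ?_⟩
  · rw [MvPolynomial.coeff_map]
    exact hone _
  · rw [MvPolynomial.coeff_map]
    exact hone _
  · rw [hdeg]
    change w' (pairRes (degree φ) fun n =>
      MvPolynomial.map (i.comp (constantField hK K').subtype) (F n)) = 1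
    rw [pairRes_map]
    exact eq_one_of_mem_constants hK (pairRes (degree φ) F).2
      (fun h0 => hres (Subtype.ext h0)) hwi

end Main

end RatMap

end

theorem theorem1p9 {K : Type u} [Field K] (MK : Set (AbsoluteValue K ℝ))
    (hK : RatMap.IsFunctionField MK) (φ : RatFunc K) (hφ : 2 ≤ RatMap.degree φ) :
    RatMap.IsIsotrivial MK φ ↔
      ∀ v ∈ MK, RatMap.HasPotentiallyGoodReduction (RatMap.completionAbs v)
        (RatMap.baseChange (RatMap.toCompletion v) φ) :=
  ⟨fun h _ hv => RatMap.potentiallyGood_of_isIsotrivial hK hφ h hv,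
    RatMap.isIsotrivial_of_potentiallyGood hK hφ⟩
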